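/- A \emph{linking pairing} on a finite abelian group $G$ is a symmetric bilinear form $\lambda\colon G\times G\to\mathbb{Q}/\mathbb{Z}$ whose adjoint homomorphism $G\to\mathrm{Hom}(G,\mathbb{Q}/\mathbb{Z})$ is bijective. Two linking pairings $(G,\lambda)$, $(G',\lambda')$ are isomorphic if there is a group isomorphism $\phi\colon G\to G'$ with $\lambda'(\phi(x),\phi(y))=\lambda(x,y)$ for all $x,y\in G$; their orthogonal sum is the pairing $((x,x'),(y,y'))\mapsto\lambda(x,y)+\lambda'(x',y')$ on $G\times G'$. Let $\mathfrak{M}$ be the commutative monoid of isomorphism classes of linking pairings on finite abelian $2$-groups, under orthogonal sum. Let $(G,\lambda)$ be a linking pairing on a finite abelian $2$-group. It has an orthogonal direct sum decomposition $G=\bigoplus_{k\ge1}G_k$ in which each $G_k$ is a free $\mathbb{Z}/2^k\mathbb{Z}$-module of finite rank, and the rank $\rho_k(\lambda)$ of $G_k$ does not depend on the decomposition. For $k\ge1$ put $$\Gamma_k(G,\lambda)=\sum_{x\in G}\exp\bigl(\pi i\,2^k\lambda(x,x)\bigr).$$ If $\Gamma_k(G,\lambda)\neq0$, then $\Gamma_k/|\Gamma_k|$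 is an eighth root of unity, and $\sigma_k(\lambda)\in\mathbb{Z}/8\mathbb{Z}$ is defined by $\Gamma_k/|\Gamma_k|=\exp(2\pi i\,\sigma_k(\lambda)/8)$; if $\Gamma_k(G,\lambda)=0$, put $\sigma_k(\lambda)=\infty$. Let $\overline{\mathbb{Z}}_8=\mathbb{Z}/8\mathbb{Z}\cup\{\infty\}$ be the monoid obtained from the group $\mathbb{Z}/8\mathbb{Z}$ by adjoining an absorbing element $\infty$. Let $\mathfrak{T}$ be the monoid, under pointwise addition, of all maps (\emph{tableaux}) $T\colon\{1,2,3,\dots\}\to\mathbb{N}\times\overline{\mathbb{Z}}_8$. A tableau $T$ is \emph{admissible} if there is a linking pairing $(G,\lambda)$ on a finite abelian $2$-group with $T(k)=(\rho_k(\lambda),\sigma_k(\lambda))$ for all $k\ge1$. Then the admissible tableaux form a submonoid $\mathfrak{T}^{\mathrm{adm}}$ of $\mathfrak{T}$, and the map $$(\rho,\sigma)\colon\mathfrak{M}\to\mathfrak{T}^{\mathrm{adm}},\qquad [(G,\lambda)]\mapsto\bigl(\rho_k(\lambda),\sigma_k(\lambda)\bigr)_{k\ge1},$$ is a well-defined isomorphism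 of monoids. -/

import Mathlib

universe u

/-- A linking pairing on a finite abelian 2-group: a symmetric bilinear form with values in
`ℚ/ℤ` whose adjoint homomorphism `G → Hom(G, ℚ/ℤ)` is bijective. -/
structure TwoLinking where
  G : Type u
  [grp : AddCommGroup G]
  [fin : Fintype G]
  form : G →+ G →+ AddCircle (1 : ℚ)
  symm : ∀ x y, form x y = form y x
  adjoint_bijective : Function.Bijective form
  two_group : ∃ n : ℕ, Fintype.card G = 2 ^ n

namespace TwoLinking

attribute [instance] TwoLinking.grp TwoLinking.fin

/-- Two linking pairings are isomorphic if there is a group isomorphism preserving the forms. -/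
def Iso (L M : TwoLinking.{u}) : Prop :=
  ∃ e : L.G ≃+ M.G, ∀ x y, M.form (e x) (e y) = L.form x y

theorem Iso.refl (L : TwoLinking.{u}) : Iso L L := ⟨AddEquiv.refl _, fun _ _ => rfl⟩

theorem Iso.symm {L M : TwoLinking.{u}} : Iso L M → Iso M L := by
  rintro ⟨e, he⟩
  exact ⟨e.symm, fun x y => by rw [← he]; simp⟩

theorem Iso.trans {L M N : TwoLinking.{u}} : Iso L M → Iso M N → Iso L N := by
  rintro ⟨e, he⟩ ⟨f, hf⟩
  exact ⟨e.trans f, fun x y => by simp [hf, he]⟩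

instance setoid : Setoid TwoLinking.{u} where
  r := Iso
  iseqv := ⟨Iso.refl, Iso.symm, Iso.trans⟩

/-- The orthogonal sum of two forms: `((x, x'), (y, y')) ↦ b x y + b' x' y'`. -/
def sumForm {G H A : Type*} [AddCommGroup G] [AddCommGroup H] [AddCommGroup A]
    (b : G →+ G →+ A) (b' : H →+ H →+ A) : G × H →+ G × H →+ A where
  toFun p := (b p.1).coprod (b' p.2)
  map_zero' := by ext; simp
  map_add' p q := by
    ext; simp [add_add_add_comm]

@[simp]
theorem sumForm_apply {G H A : Type*} [AddCommGroup G] [AddCommGroup H] [AddCommGroup A]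
    (b : G →+ G →+ A) (b' : H →+ H →+ A) (p q : G × H) :
    sumForm b b' p q = b p.1 q.1 + b' p.2 q.2 := rfl

theorem sumForm_bijective {G H A : Type*} [AddCommGroup G] [AddCommGroup H] [AddCommGroup A]
    {b : G →+ G →+ A} {b' : H →+ H →+ A}
    (hb : Function.Bijective b) (hb' : Function.Bijective b') :
    Function.Bijective (sumForm b b') := by
  constructor
  · rintro ⟨x, x'⟩ ⟨y, y'⟩ h
    have h1 : x = y := hb.1 (by
      ext z; simpa using DFunLike.congr_fun h (z, 0))
    have h2 : x' = y' := hb'.1 (by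
      ext z; simpa using DFunLike.congr_fun h (0, z))
    rw [h1, h2]
  · intro f
    obtain ⟨x, hx⟩ := hb.2 (f.comp (AddMonoidHom.inl G H))
    obtain ⟨y, hy⟩ := hb'.2 (f.comp (AddMonoidHom.inr G H))
    refine ⟨(x, y), ?_⟩
    ext z
    simp [hx, hy, ← map_add]

/-- The orthogonal sum of two linking pairings. -/
def sum (L M : TwoLinking.{u}) : TwoLinking.{u} where
  G := L.G × M.G
  form := sumForm L.form M.form
  symm p q := by simp [L.symm p.1, M.symm p.2]
  adjoint_bijective := sumForm_bijective L.adjoint_bijective M.adjoint_bijective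
  two_group := by
    obtain ⟨m, hm⟩ := L.two_group
    obtain ⟨n, hn⟩ := M.two_group
    exact ⟨m + n, by rw [Fintype.card_prod, hm, hn, pow_add]⟩

/-- The linking pairing on the trivial group. -/
def trivial : TwoLinking.{u} where
  G := PUnit
  form := 0
  symm _ _ := rfl
  adjoint_bijective :=
    ⟨fun _ _ _ => rfl, fun f => ⟨0, by
      ext x
      have hx : x = 0 := rfl
      rw [hx, map_zero, map_zero]⟩⟩
  two_group := ⟨0, by simp⟩

theorem sum_congr {L L' M M' : TwoLinking.{u}} :
    Iso L L' → Iso M M' → Iso (sum L M) (sum L' M') := by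
  rintro ⟨e, he⟩ ⟨f, hf⟩
  exact ⟨e.prodCongr f, fun x y => congrArg₂ (· + ·) (he x.1 y.1) (hf x.2 y.2)⟩

theorem sum_comm (L M : TwoLinking.{u}) : Iso (sum L M) (sum M L) :=
  ⟨AddEquiv.prodComm, fun _ _ => add_comm _ _⟩

theorem sum_assoc (L M N : TwoLinking.{u}) : Iso (sum (sum L M) N) (sum L (sum M N)) :=
  ⟨AddEquiv.prodAssoc, fun _ _ => (add_assoc _ _ _).symm⟩

theorem trivial_sum (L : TwoLinking.{u}) : Iso (sum trivial L) L :=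
  ⟨AddEquiv.uniqueProd (M := L.G) (N := PUnit), fun _ _ => (zero_add _).symm⟩

/-- The function `t ↦ exp(π i 2 ^ k t)` on `ℚ` is 1-periodic for `k ≥ 1`. -/
theorem exp_periodic (k : ℕ+) :
    Function.Periodic
      (fun t : ℚ => Complex.exp (Real.pi * Complex.I * 2 ^ (k : ℕ) * (t : ℂ))) 1 := by
  intro t
  obtain ⟨j, hj⟩ := Nat.exists_eq_succ_of_ne_zero k.ne_zero
  have : (Real.pi * Complex.I * 2 ^ (k : ℕ) * ((t + 1 : ℚ) : ℂ) : ℂ)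
      = Real.pi * Complex.I * 2 ^ (k : ℕ) * (t : ℂ)
        + ((2 ^ j : ℕ) : ℂ) * (2 * Real.pi * Complex.I) := by
    rw [hj, pow_succ]; push_cast; ring
  simp only [this, Complex.exp_add, Complex.exp_nat_mul_two_pi_mul_I, mul_one]

/-- The Gauss sum `Γ_k(G, λ) = ∑_{x ∈ G} exp(π i 2 ^ k λ(x, x))`, for `k ≥ 1`. -/
noncomputable def gaussSum (L : TwoLinking.{u}) (k : ℕ+) : ℂ :=
  ∑ x : L.G, (exp_periodic k).lift (L.form x x)

/-- `L.HasSignature k s` says `σ_k(L) = s`, where `s` is `∞` (written `⊤`) if `Γ_k = 0`, and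
otherwise `s ∈ ℤ/8` is such that `Γ_k / |Γ_k| = exp(2 π i s / 8)`. -/
def HasSignature (L : TwoLinking.{u}) (k : ℕ+) : WithTop (ZMod 8) → Prop
  | none => L.gaussSum k = 0
  | some a => L.gaussSum k ≠ 0 ∧
      L.gaussSum k / (‖L.gaussSum k‖ : ℂ) = Complex.exp (2 * Real.pi * Complex.I * a.val / 8)

/-- `L.HasRanks r` says that `L` is the orthogonal direct sum of subgroups `H k`, `k ≥ 1`, where
`H k` is a free `ℤ/2^k`-module of rank `r k`. -/
def HasRanks (L : TwoLinking.{u}) (r : ℕ+ → ℕ) : Prop :=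
  ∃ H : ℕ+ → AddSubgroup L.G,
    DirectSum.IsInternal H ∧
    (∀ i j, i ≠ j → ∀ x ∈ H i, ∀ y ∈ H j, L.form x y = 0) ∧
    ∀ k, Nonempty (H k ≃+ (Fin (r k) → ZMod (2 ^ (k : ℕ))))

end TwoLinking

/-- The monoid of isomorphism classes of linking pairings on finite 2-groups. -/
def LinkingMonoid : Type (u + 1) := Quotient TwoLinking.setoid.{u}

namespace LinkingMonoid

/-- The isomorphism class of a linking pairing. -/
def mk (L : TwoLinking.{u}) : LinkingMonoid.{u} := Quotient.mk _ L

/-- Addition is induced by the orthogonal sum. -/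
instance : Add LinkingMonoid.{u} :=
  ⟨Quotient.map₂ TwoLinking.sum fun _ _ h _ _ h' => TwoLinking.sum_congr h h'⟩

instance : Zero LinkingMonoid.{u} := ⟨mk TwoLinking.trivial⟩

theorem mk_add_mk (L M : TwoLinking.{u}) : mk L + mk M = mk (L.sum M) := rfl

theorem add_comm' (a b : LinkingMonoid.{u}) : a + b = b + a :=
  Quotient.inductionOn₂ a b fun L M => Quotient.sound (TwoLinking.sum_comm L M)

theorem zero_add' (a : LinkingMonoid.{u}) : 0 + a = a :=
  Quotient.inductionOn a fun L => Quotient.sound (TwoLinking.trivial_sum L)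

instance : AddCommMonoid LinkingMonoid.{u} where
  add_assoc a b c := Quotient.inductionOn₃ a b c fun L M N =>
    Quotient.sound (TwoLinking.sum_assoc L M N)
  zero_add := zero_add'
  add_zero a := (add_comm' a 0).trans (zero_add' a)
  add_comm := add_comm'
  nsmul := nsmulRec

end LinkingMonoid

/-- The monoid of tableaux `m ↦ (r m, s m)`, `m ≥ 1`, with values in `ℕ × (ℤ/8 ∪ {∞})` and
pointwise addition, where `∞ + a = a + ∞ = ∞`. -/
abbrev Tableau : Type := ℕ+ → ℕ × WithTop (ZMod 8)

/-- `L.HasInvariants T` says that `T` is the tableau `(ρ_k(L), σ_k(L))_{k ≥ 1}`. -/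
def TwoLinking.HasInvariants (L : TwoLinking.{u}) (T : Tableau) : Prop :=
  L.HasRanks (fun k => (T k).1) ∧ ∀ k, L.HasSignature k (T k).2

/-- A tableau is admissible if it is the tableau of invariants of some linking pairing on a
finite 2-group. -/
def Tableau.IsAdmissible (T : Tableau) : Prop :=
  ∃ L : TwoLinking.{u}, L.HasInvariants T

/-! Additivity of ranks and signatures follows from multiplicativity of Gauss sums (`gaussSum_sum`),
so the substance is that the invariants are well defined and complete.

Signatures exist because `-1` is a sum of four squares modulo the order of `G`: multiplication by
the corresponding quaternion carries four copies of `λ` to four copies of `-λ`, so `Γ_k ^ 4` equals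
its conjugate (`gaussSum_pow_four`). Existence of ranks follows by splitting off blocks of maximal
exponent (`exists_hasRanks`), uniqueness by counting elements of order at most two that are
divisible by `2 ^ m` (`card_socle_stdGroup`).

For completeness, a nonzero `Γ_k` has squared absolute value `|G|` times the number of elements
killed by `2 ^ k`. Ranks and signatures therefore determine the Gauss sums themselves, and
`SameInvariants` suffices. The Gauss sums in turn determine how often each value `λ(x, x)` occurs
(`exists_equiv_of_gaussSum_eq`): there is a norm-preserving bijection `τ`, in general not additive.

Then one inducts on `|G|`, with exponent `2 ^ (n + 1)`, splitting the same summand off both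
pairings. If `2 ^ n λ(x, x)` always vanishes (`iso_of_even`), the summand is a hyperbolic plane or
the anisotropic plane; counting norms decides which occurs, and its Gauss sums never vanish, so they
cancel. Otherwise (`iso_of_odd`) it is cyclic, generated by `x` and `τ x`. Its Gauss sum vanishes
only at `k = n + 1`, where the complement's sum is zero or its order according to parity. The two
parities agree if `x` and `τ x` both avoid the characteristic elements, which a count permits unless
the top layer is so small that its size fixes the parity. -/

namespace TwoLinking

/-! ### The character of `ℚ/ℤ` and dyadic fractions. -/

/-- The additive character `t ↦ exp(2 π i t)` of `ℚ/ℤ`. -/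
noncomputable def expChar : AddChar (AddCircle (1 : ℚ)) ℂ where
  toFun := (exp_periodic 1).lift
  map_zero_eq_one' := by
    have := (exp_periodic 1).lift_coe 0
    simpa using this
  map_add_eq_mul' a b := by
    induction a using QuotientAddGroup.induction_on with | _ a => ?_
    induction b using QuotientAddGroup.induction_on with | _ b => ?_
    rw [← QuotientAddGroup.mk_add]
    erw [(exp_periodic 1).lift_coe, (exp_periodic 1).lift_coe, (exp_periodic 1).lift_coe]
    rw [← Complex.exp_add]
    congr 1
    push_cast
    ring

theorem expChar_coe (t : ℚ) :
    expChar (t : AddCircle (1 : ℚ)) = Complex.exp (2 * Real.pi * Complex.I * (t : ℂ)) := by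
  have := (exp_periodic 1).lift_coe t
  refine this.trans ?_
  congr 1
  rw [PNat.one_coe, pow_one]
  ring

theorem expChar_eq_one_iff (a : AddCircle (1 : ℚ)) : expChar a = 1 ↔ a = 0 := by
  induction a using QuotientAddGroup.induction_on with | _ t => ?_
  have h1 : expChar (t : AddCircle (1 : ℚ)) = 1 ↔ ((t : ℚ) : AddCircle (1 : ℚ)) = 0 := by
    rw [expChar_coe, Complex.exp_eq_one_iff, AddCircle.coe_eq_zero_iff]
    refine exists_congr fun n => ?_
    rw [mul_comm (n : ℂ), mul_right_inj' Complex.two_pi_I_ne_zero]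
    constructor
    · intro h
      have h2 : t = (n : ℚ) := by exact_mod_cast h
      simp [h2]
    · intro h
      rw [← h]
      simp
  exact h1

theorem expChar_norm (a : AddCircle (1 : ℚ)) : ‖expChar a‖ = 1 := by
  induction a using QuotientAddGroup.induction_on with | _ t => ?_
  have h1 : ‖expChar (t : AddCircle (1 : ℚ))‖ = 1 := by
    rw [expChar_coe]
    have : (2 * Real.pi * Complex.I * (t : ℂ) : ℂ) = ((2 * Real.pi * t : ℝ) : ℂ) * Complex.I := by
      push_cast; ring
    rw [this, Complex.norm_exp_ofReal_mul_I]
  exact h1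

theorem expChar_neg (a : AddCircle (1 : ℚ)) :
    expChar (-a) = (starRingEnd ℂ) (expChar a) := by
  rw [AddChar.map_neg_eq_inv, Complex.inv_eq_conj (expChar_norm a)]

theorem lift_eq_expChar (k : ℕ+) (a : AddCircle (1 : ℚ)) :
    (exp_periodic k).lift a = expChar (2 ^ ((k : ℕ) - 1) • a) := by
  induction a using QuotientAddGroup.induction_on with | _ t => ?_
  have h1 : expChar (2 ^ ((k : ℕ) - 1) • (t : AddCircle (1 : ℚ))) =
      Complex.exp (Real.pi * Complex.I * 2 ^ (k : ℕ) * (t : ℂ)) := by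
    rw [← AddCircle.coe_nsmul, expChar_coe]
    congr 1
    obtain ⟨j, hj⟩ := Nat.exists_eq_succ_of_ne_zero k.ne_zero
    rw [hj]
    simp [pow_succ]
    ring
  exact ((exp_periodic k).lift_coe t).trans h1.symm

theorem gaussSum_eq (L : TwoLinking.{u}) (k : ℕ+) :
    L.gaussSum k = ∑ x : L.G, expChar (2 ^ ((k : ℕ) - 1) • L.form x x) :=
  Finset.sum_congr rfl fun _ _ => lift_eq_expChar k _

/-- The homomorphism `m ↦ m / 2 ^ N` from `ℤ` to `ℚ/ℤ`. -/
noncomputable def fr (N : ℕ) : ℤ →+ AddCircle (1 : ℚ) where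
  toFun m := ((m / 2 ^ N : ℚ) : AddCircle (1 : ℚ))
  map_zero' := by simp
  map_add' a b := by
    rw [← AddCircle.coe_add]; congr 1; push_cast; ring

theorem fr_apply (N : ℕ) (m : ℤ) : fr N m = ((m / 2 ^ N : ℚ) : AddCircle (1 : ℚ)) := rfl

theorem fr_eq_zero_iff (N : ℕ) (m : ℤ) : fr N m = 0 ↔ (2 : ℤ) ^ N ∣ m := by
  rw [fr_apply, AddCircle.coe_eq_zero_iff]
  have h2 : (2 : ℚ) ^ N ≠ 0 := by positivity
  constructor
  · rintro ⟨n, hn⟩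
    refine ⟨n, ?_⟩
    rw [zsmul_eq_mul, mul_one, eq_div_iff h2] at hn
    have : (m : ℚ) = ((2 ^ N * n : ℤ) : ℚ) := by rw [← hn]; push_cast; ring
    exact_mod_cast this
  · rintro ⟨n, rfl⟩
    refine ⟨n, ?_⟩
    rw [zsmul_eq_mul, mul_one, eq_div_iff h2]
    push_cast; ring

theorem fr_eq_iff (N : ℕ) (m n : ℤ) : fr N m = fr N n ↔ (2 : ℤ) ^ N ∣ m - n := by
  rw [← sub_eq_zero, ← map_sub, fr_eq_zero_iff]

theorem nsmul_fr (N c : ℕ) (m : ℤ) : c • fr N m = fr N (c * m) := by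
  rw [← map_nsmul]; simp

theorem zsmul_fr (N : ℕ) (c m : ℤ) : c • fr N m = fr N (c * m) := by
  rw [← map_zsmul]; simp

theorem exists_fr (N : ℕ) (a : AddCircle (1 : ℚ)) (h : 2 ^ N • a = 0) : ∃ m : ℤ, a = fr N m := by
  induction a using QuotientAddGroup.induction_on with | _ t => ?_
  have h1 : (((2 ^ N : ℕ) • t : ℚ) : AddCircle (1 : ℚ)) = 0 := by
    rw [AddCircle.coe_nsmul]; exact h
  rw [AddCircle.coe_eq_zero_iff] at h1
  obtain ⟨m, hm⟩ := h1
  refine ⟨m, ?_⟩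
  rw [fr_apply]
  have h2 : (2 : ℚ) ^ N ≠ 0 := by positivity
  have : (t : ℚ) = m / 2 ^ N := by
    rw [eq_div_iff h2]
    simp at hm
    rw [hm]; ring
  rw [← this]

theorem two_pow_nsmul_fr_eq_zero_iff (n : ℕ) (m : ℤ) :
    2 ^ n • fr (n + 1) m = 0 ↔ (2 : ℤ) ∣ m := by
  rw [nsmul_fr, fr_eq_zero_iff, pow_succ]
  push_cast
  exact mul_dvd_mul_iff_left (by positivity)

theorem two_pow_nsmul_fr_add_two_eq_zero_iff (n : ℕ) (m : ℤ) :
    2 ^ n • fr (n + 2) m = 0 ↔ (4 : ℤ) ∣ m := by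
  rw [nsmul_fr, fr_eq_zero_iff, pow_add]
  push_cast
  exact mul_dvd_mul_iff_left (by positivity)

/-- An element of `ℚ/ℤ` killed by two takes two values under the character. -/
theorem expChar_of_two_nsmul {a : AddCircle (1 : ℚ)} (h : 2 • a = 0) (h0 : a ≠ 0) :
    expChar a = -1 := by
  have h1 : expChar a ^ 2 = 1 := by
    rw [← AddChar.map_nsmul_eq_pow, h, AddChar.map_zero_eq_one]
  rcases (sq_eq_sq_iff_eq_or_eq_neg.mp (h1.trans (one_pow 2).symm)) with h2 | h2
  · exact absurd ((expChar_eq_one_iff a).mp h2) h0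
  · exact h2

theorem eq_of_two_nsmul {a b : AddCircle (1 : ℚ)} (ha : 2 • a = 0) (hb : 2 • b = 0)
    (ha0 : a ≠ 0) (hb0 : b ≠ 0) : a = b := by
  have h : expChar (a - b) = 1 := by
    rw [AddChar.map_sub_eq_div, expChar_of_two_nsmul ha ha0, expChar_of_two_nsmul hb hb0]
    norm_num
  exact sub_eq_zero.mp ((expChar_eq_one_iff _).mp h)

/-! ### Gauss sums: multiplicativity, vanishing and absolute value. -/

theorem gaussSum_congr {L M : TwoLinking.{u}} (h : Iso L M) (k : ℕ+) :
    L.gaussSum k = M.gaussSum k := by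
  obtain ⟨e, he⟩ := h
  rw [gaussSum_eq, gaussSum_eq]
  exact Fintype.sum_equiv e.toEquiv _ _ fun x => by simp [he]

theorem gaussSum_sum (L M : TwoLinking.{u}) (k : ℕ+) :
    (sum L M).gaussSum k = L.gaussSum k * M.gaussSum k := by
  rw [gaussSum_eq, gaussSum_eq, gaussSum_eq, Finset.sum_mul_sum]
  refine (Fintype.sum_prod_type _).trans ?_
  refine Finset.sum_congr rfl fun x _ => Finset.sum_congr rfl fun y _ => ?_
  rw [← AddChar.map_add_eq_mul, ← nsmul_add]
  rfl

theorem form_add_self (L : TwoLinking.{u}) (x y : L.G) :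
    L.form (x + y) (x + y) = L.form x x + L.form y y + 2 • L.form x y := by
  simp only [map_add, AddMonoidHom.add_apply, L.symm y x]
  abel

theorem form_eq_zero (L : TwoLinking.{u}) {x : L.G} (h : ∀ y, L.form x y = 0) : x = 0 :=
  L.adjoint_bijective.1 (by ext y; simp [h])

theorem exists_form_ne_zero (L : TwoLinking.{u}) {x : L.G} (h : x ≠ 0) :
    ∃ y, L.form x y ≠ 0 := by
  by_contra! h'
  exact h (L.form_eq_zero h')

theorem nsmul_form (L : TwoLinking.{u}) (n : ℕ) (x y : L.G) :
    n • L.form x y = L.form (n • x) y := by simp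

/-- The sum of a nontrivial character over a finite group is zero. -/
theorem sum_char_eq_zero {A : Type*} [AddCommGroup A] [Fintype A] (ψ : A → ℂ)
    (h : ∀ a b, ψ (a + b) = ψ a * ψ b) {a : A} (ha : ψ a ≠ 1) : ∑ x, ψ x = 0 := by
  have h1 : ∑ x, ψ x = ψ a * ∑ x, ψ x := by
    rw [Finset.mul_sum]
    simp_rw [← h]
    exact (Equiv.sum_comp (Equiv.addLeft a) ψ).symm
  have h2 : (1 - ψ a) * ∑ x, ψ x = 0 := by linear_combination h1
  rcases mul_eq_zero.mp h2 with h3 | h3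
  · exact absurd (sub_eq_zero.mp h3).symm ha
  · exact h3

/-- The number of elements killed by `2 ^ k`. -/
noncomputable def torsionCard (A : Type*) [AddCommGroup A] (k : ℕ) : ℕ :=
  Nat.card {x : A // 2 ^ k • x = 0}

-- Substituting `x = z + y` turns the double sum into one whose inner sum over `y` is that of the
-- character `2 ^ k λ(z, ·)`. By nondegeneracy this is trivial only when `2 ^ k` kills `z`.
open Classical in
theorem gaussSum_mul_conj (L : TwoLinking.{u}) (k : ℕ+) :
    L.gaussSum k * (starRingEnd ℂ) (L.gaussSum k) = Fintype.card L.G *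
      ∑ z : {x : L.G // 2 ^ (k : ℕ) • x = 0}, expChar (2 ^ ((k : ℕ) - 1) • L.form z z) := by
  obtain ⟨j, hj⟩ := Nat.exists_eq_succ_of_ne_zero k.ne_zero
  have hk : (k : ℕ) = j + 1 := hj
  have key : ∀ z : L.G, ∑ y : L.G, expChar (2 ^ (j + 1) • L.form z y) =
      if 2 ^ (j + 1) • z = 0 then (Fintype.card L.G : ℂ) else 0 := by
    intro z
    split_ifs with hz
    · simp_rw [nsmul_form, hz]
      simp
    · obtain ⟨y, hy⟩ := L.exists_form_ne_zero hz
      refine sum_char_eq_zero (a := y) _ (fun a b => ?_) ?_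
      · rw [map_add, nsmul_add, AddChar.map_add_eq_mul]
      · rw [Ne, expChar_eq_one_iff, nsmul_form]
        exact hy
  rw [gaussSum_eq, hk, Nat.add_sub_cancel, map_sum, Finset.sum_mul_sum, Finset.sum_comm]
  have step : ∀ y : L.G, ∑ x : L.G, expChar (2 ^ j • L.form x x) *
      (starRingEnd ℂ) (expChar (2 ^ j • L.form y y)) =
      ∑ z : L.G, expChar (2 ^ j • L.form z z) * expChar (2 ^ (j + 1) • L.form z y) := by
    intro y
    rw [← Equiv.sum_comp (Equiv.addRight y)]
    refine Finset.sum_congr rfl fun z _ => ?_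
    rw [← expChar_neg, ← AddChar.map_add_eq_mul, ← AddChar.map_add_eq_mul]
    congr 1
    rw [Equiv.coe_addRight, form_add_self, pow_succ, mul_nsmul, nsmul_add, nsmul_add,
      nsmul_left_comm]
    abel
  simp_rw [step]
  rw [Finset.sum_comm]
  simp_rw [← Finset.mul_sum, key]
  simp only [mul_ite, mul_zero]
  rw [← Finset.sum_filter, Finset.mul_sum]
  rw [← Finset.sum_subtype_eq_sum_filter]
  simp only [Finset.subtype_univ, mul_comm]

/-- On the `2 ^ k`-torsion the map `z ↦ 2 ^ (k - 1) λ(z, z)` is additive. -/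
theorem two_pow_nsmul_form_add_self (L : TwoLinking.{u}) (j : ℕ) {x : L.G}
    (hx : 2 ^ (j + 1) • x = 0) (y : L.G) :
    2 ^ j • L.form (x + y) (x + y) = 2 ^ j • L.form x x + 2 ^ j • L.form y y := by
  rw [form_add_self, nsmul_add, ← mul_nsmul', ← pow_succ, nsmul_form _ (2 ^ (j + 1)), hx]
  simp

/-- The subgroup of elements killed by `2 ^ k`. -/
def torsionSubgroup (A : Type*) [AddCommGroup A] (k : ℕ) : AddSubgroup A :=
  (nsmulAddMonoidHom (α := A) (2 ^ k)).ker

theorem mem_torsionSubgroup {A : Type*} [AddCommGroup A] {k : ℕ} {x : A} :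
    x ∈ torsionSubgroup A k ↔ 2 ^ k • x = 0 := Iff.rfl

-- On the `2 ^ k`-torsion the summand is a character, so orthogonality leaves the order of the
-- torsion group or zero.
open Classical in
theorem sum_torsion_eq (L : TwoLinking.{u}) (k : ℕ+) :
    (∑ z : {x : L.G // 2 ^ (k : ℕ) • x = 0}, expChar (2 ^ ((k : ℕ) - 1) • L.form z z)) =
      if ∀ z : L.G, 2 ^ (k : ℕ) • z = 0 → 2 ^ ((k : ℕ) - 1) • L.form z z = 0 then
        (torsionCard L.G k : ℂ) else 0 := by
  obtain ⟨j, hj⟩ := Nat.exists_eq_succ_of_ne_zero k.ne_zero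
  have hk : (k : ℕ) = j + 1 := hj
  split_ifs with h
  · rw [Finset.sum_congr rfl fun z _ => by rw [h z.1 z.2, AddChar.map_zero_eq_one]]
    simp [torsionCard, Nat.card_eq_fintype_card]
  · push Not at h
    obtain ⟨z, hz, hz'⟩ := h
    refine sum_char_eq_zero (A := torsionSubgroup L.G k)
      (fun z => expChar (2 ^ ((k : ℕ) - 1) • L.form z.1 z.1)) (fun a b => ?_)
      (a := ⟨z, hz⟩) ?_
    · have ha : 2 ^ (j + 1) • a.1 = 0 := by rw [← hk]; exact a.2
      have hj' : (k : ℕ) - 1 = j := by lia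
      simp only [hj', AddSubgroup.coe_add]
      rw [← AddChar.map_add_eq_mul, L.two_pow_nsmul_form_add_self j ha]
    · rwa [Ne, expChar_eq_one_iff]

theorem gaussSum_ne_zero_iff (L : TwoLinking.{u}) (k : ℕ+) :
    L.gaussSum k ≠ 0 ↔
      ∀ z : L.G, 2 ^ (k : ℕ) • z = 0 → 2 ^ ((k : ℕ) - 1) • L.form z z = 0 := by
  classical
  have h := L.gaussSum_mul_conj k
  rw [sum_torsion_eq] at h
  constructor
  · intro h0
    by_contra h1
    rw [if_neg h1, mul_zero, mul_eq_zero, map_eq_zero, or_self] at h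
    exact h0 h
  · intro h1 h0
    rw [if_pos h1, h0, zero_mul] at h
    have : Nonempty {x : L.G // 2 ^ (k : ℕ) • x = 0} := ⟨⟨0, by simp⟩⟩
    have hpos : torsionCard L.G k ≠ 0 := Nat.card_ne_zero.mpr ⟨this, inferInstance⟩
    have hG : Fintype.card L.G ≠ 0 := Fintype.card_ne_zero
    exact mul_ne_zero (Nat.cast_ne_zero.mpr hG) (Nat.cast_ne_zero.mpr hpos) h.symm

theorem norm_gaussSum_sq (L : TwoLinking.{u}) (k : ℕ+) (h : L.gaussSum k ≠ 0) :
    ‖L.gaussSum k‖ ^ 2 = Fintype.card L.G * torsionCard L.G k := by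
  classical
  have h1 := L.gaussSum_mul_conj k
  rw [sum_torsion_eq, if_pos ((L.gaussSum_ne_zero_iff k).mp h), Complex.mul_conj'] at h1
  exact_mod_cast h1

/-- If `2 ^ k` kills `G`, the Gauss sum at `k` is the order of `G` or zero. -/
theorem gaussSum_of_exponent (L : TwoLinking.{u}) (k : ℕ+) (hL : ∀ x : L.G, 2 ^ (k : ℕ) • x = 0)
    (h : L.gaussSum k ≠ 0) : L.gaussSum k = Fintype.card L.G := by
  rw [gaussSum_ne_zero_iff] at h
  rw [gaussSum_eq, Finset.sum_congr rfl fun z _ => by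
    rw [h z (hL z), AddChar.map_zero_eq_one]]
  simp

/-! ### Signatures as eighth roots of unity. -/

/-- Multiplication by a quaternion of norm `-1` shows that four copies of a form are isomorphic to
four copies of its negative. -/
theorem gaussSum_pow_four (L : TwoLinking.{u}) (k : ℕ+) :
    L.gaussSum k ^ 4 = (starRingEnd ℂ) (L.gaussSum k) ^ 4 := by
  obtain ⟨n, hn⟩ := L.two_group
  -- The order `2 ^ n` kills `G`, so `2 ^ n - 1` acts as `-1`; Lagrange's theorem makes it a
  -- quaternion norm.
  obtain ⟨a, b, c, d, habcd⟩ := Nat.sum_four_squares (2 ^ n - 1)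
  have hG : ∀ x : L.G, (2 ^ n : ℤ) • x = 0 := fun x => by
    have := card_nsmul_eq_zero (x := x)
    rw [hn] at this
    exact_mod_cast this
  have hN : (a : ℤ) ^ 2 + b ^ 2 + c ^ 2 + d ^ 2 = 2 ^ n - 1 := by
    have : 1 ≤ 2 ^ n := Nat.one_le_two_pow
    zify [this] at habcd
    exact habcd
  have neg : ∀ x : L.G, ((a : ℤ) ^ 2 + b ^ 2 + c ^ 2 + d ^ 2) • x = -x := fun x => by
    rw [hN, sub_smul, hG, one_smul, zero_sub]
  have neg' : ∀ x y : L.G, ((a : ℤ) ^ 2 + b ^ 2 + c ^ 2 + d ^ 2) • L.form x y = -L.form x y :=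
    fun x y => by
      rw [← AddMonoidHom.zsmul_apply, ← map_zsmul, neg, map_neg, AddMonoidHom.neg_apply]
  let U : L.G × L.G × L.G × L.G → L.G × L.G × L.G × L.G := fun p =>
    ((a : ℤ) • p.1 - (b : ℤ) • p.2.1 - (c : ℤ) • p.2.2.1 - (d : ℤ) • p.2.2.2,
      (b : ℤ) • p.1 + (a : ℤ) • p.2.1 - (d : ℤ) • p.2.2.1 + (c : ℤ) • p.2.2.2,
      (c : ℤ) • p.1 + (d : ℤ) • p.2.1 + (a : ℤ) • p.2.2.1 - (b : ℤ) • p.2.2.2,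
      (d : ℤ) • p.1 - (c : ℤ) • p.2.1 + (b : ℤ) • p.2.2.1 + (a : ℤ) • p.2.2.2)
  have hinj : Function.Injective U := by
    rintro ⟨x, y, z, w⟩ ⟨x', y', z', w'⟩ h
    simp only [U, Prod.mk.injEq] at h
    -- Multiplying by the conjugate quaternion recovers each coordinate up to sign.
    obtain ⟨h1, h2, h3, h4⟩ := h
    have e1 : ((a : ℤ) ^ 2 + b ^ 2 + c ^ 2 + d ^ 2) • x =
        ((a : ℤ) ^ 2 + b ^ 2 + c ^ 2 + d ^ 2) • x' := by
      linear_combination (norm := module) (a : ℤ) • h1 + (b : ℤ) • h2 + (c : ℤ) • h3 + (d : ℤ) • h4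
    have e2 : ((a : ℤ) ^ 2 + b ^ 2 + c ^ 2 + d ^ 2) • y =
        ((a : ℤ) ^ 2 + b ^ 2 + c ^ 2 + d ^ 2) • y' := by
      linear_combination (norm := module) -(b : ℤ) • h1 + (a : ℤ) • h2 + (d : ℤ) • h3 - (c : ℤ) • h4
    have e3 : ((a : ℤ) ^ 2 + b ^ 2 + c ^ 2 + d ^ 2) • z =
        ((a : ℤ) ^ 2 + b ^ 2 + c ^ 2 + d ^ 2) • z' := by
      linear_combination (norm := module) -(c : ℤ) • h1 - (d : ℤ) • h2 + (a : ℤ) • h3 + (b : ℤ) • h4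
    have e4 : ((a : ℤ) ^ 2 + b ^ 2 + c ^ 2 + d ^ 2) • w =
        ((a : ℤ) ^ 2 + b ^ 2 + c ^ 2 + d ^ 2) • w' := by
      linear_combination (norm := module) -(d : ℤ) • h1 + (c : ℤ) • h2 - (b : ℤ) • h3 + (a : ℤ) • h4
    rw [neg, neg, neg_inj] at e1 e2 e3 e4
    rw [e1, e2, e3, e4]
  have hbij := (Finite.injective_iff_bijective.mp hinj)
  let Q : L.G × L.G × L.G × L.G → AddCircle (1 : ℚ) := fun p =>
    L.form p.1 p.1 + (L.form p.2.1 p.2.1 + (L.form p.2.2.1 p.2.2.1 + L.form p.2.2.2 p.2.2.2))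
  have hQ : ∀ p, Q (U p) = -Q p := by
    rintro ⟨x, y, z, w⟩
    simp only [Q, U, map_add, map_sub, map_zsmul, AddMonoidHom.add_apply, AddMonoidHom.sub_apply,
      AddMonoidHom.zsmul_apply, neg_add, ← neg', L.symm y x, L.symm z x, L.symm w x, L.symm z y,
      L.symm w y, L.symm w z]
    module
  have hS : ∀ g : AddCircle (1 : ℚ) → ℂ, (∀ s t, g (s + t) = g s * g t) →
      (∑ x : L.G, g (L.form x x)) ^ 4 = ∑ p : L.G × L.G × L.G × L.G, g (Q p) := by
    intro g hg
    simp only [Fintype.sum_prod_type, Q, hg, ← Finset.mul_sum, ← Finset.sum_mul]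
    ring
  rw [gaussSum_eq, map_sum]
  simp_rw [← expChar_neg, ← smul_neg]
  rw [hS (fun t => expChar (2 ^ ((k : ℕ) - 1) • t)) (fun s t => by
      rw [nsmul_add, AddChar.map_add_eq_mul]),
    hS (fun t => expChar (2 ^ ((k : ℕ) - 1) • -t)) (fun s t => by
      rw [neg_add, nsmul_add, AddChar.map_add_eq_mul])]
  rw [← hbij.sum_comp fun p => expChar (2 ^ ((k : ℕ) - 1) • -Q p)]
  simp_rw [hQ, neg_neg]

theorem exp_val_eq_stdAddChar (a : ZMod 8) :
    Complex.exp (2 * Real.pi * Complex.I * a.val / 8) = ZMod.stdAddChar a := by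
  have h := ZMod.stdAddChar_coe (N := 8) (a.val : ℤ)
  rw [Int.cast_natCast, ZMod.natCast_zmod_val] at h
  rw [h]
  push_cast
  rfl

theorem hasSignature_top_iff (L : TwoLinking.{u}) (k : ℕ+) :
    L.HasSignature k ⊤ ↔ L.gaussSum k = 0 := Iff.rfl

theorem hasSignature_coe_iff (L : TwoLinking.{u}) (k : ℕ+) (a : ZMod 8) :
    L.HasSignature k (a : WithTop (ZMod 8)) ↔ L.gaussSum k ≠ 0 ∧
      L.gaussSum k / (‖L.gaussSum k‖ : ℂ) = ZMod.stdAddChar a := by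
  rw [← exp_val_eq_stdAddChar]; rfl

theorem exists_hasSignature (L : TwoLinking.{u}) (k : ℕ+) : ∃ s, L.HasSignature k s := by
  by_cases h : L.gaussSum k = 0
  · exact ⟨⊤, h⟩
  set z := L.gaussSum k with hz
  have hn : (‖z‖ : ℂ) ≠ 0 := by simpa using h
  -- Since `z ^ 4` equals its conjugate, `z ^ 8 = (z * conj z) ^ 4 = ‖z‖ ^ 8`.
  have h8 : (z / (‖z‖ : ℂ)) ^ 8 = 1 := by
    rw [div_pow, div_eq_one_iff_eq (pow_ne_zero _ hn)]
    calc z ^ 8 = z ^ 4 * z ^ 4 := by ring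
      _ = z ^ 4 * (starRingEnd ℂ) z ^ 4 := by rw [← L.gaussSum_pow_four k]
      _ = (z * (starRingEnd ℂ) z) ^ 4 := by ring
      _ = (‖z‖ : ℂ) ^ 8 := by rw [Complex.mul_conj']; ring
  have hu : z / (‖z‖ : ℂ) ≠ 0 := div_ne_zero h hn
  have h9 : Units.mk0 _ hu ∈ rootsOfUnity 8 ℂ := by
    rw [mem_rootsOfUnity]
    ext
    simpa using h8
  obtain ⟨i, -, hi⟩ := (Complex.mem_rootsOfUnity 8 _).mp h9
  refine ⟨((i : ZMod 8) : WithTop (ZMod 8)), (L.hasSignature_coe_iff k _).mpr ⟨h, ?_⟩⟩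
  have := ZMod.stdAddChar_coe (N := 8) (i : ℤ)
  rw [Int.cast_natCast] at this
  rw [this, ← hz]
  simp only [Units.val_mk0] at hi
  rw [← hi]
  congr 1
  push_cast
  ring

theorem HasSignature.unique {L : TwoLinking.{u}} {k : ℕ+} {s t : WithTop (ZMod 8)}
    (hs : L.HasSignature k s) (ht : L.HasSignature k t) : s = t := by
  induction s with
  | top =>
    induction t with
    | top => rfl
    | coe b => exact absurd hs ((hasSignature_coe_iff _ _ _).mp ht).1
  | coe a =>
    rw [hasSignature_coe_iff] at hs
    induction t with
    | top => exact absurd ht hs.1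
    | coe b =>
      rw [hasSignature_coe_iff] at ht
      rw [ZMod.injective_stdAddChar (hs.2.symm.trans ht.2)]

theorem HasSignature.congr {L M : TwoLinking.{u}} (h : Iso L M) {k : ℕ+} {s : WithTop (ZMod 8)}
    (hs : L.HasSignature k s) : M.HasSignature k s := by
  induction s with
  | top => exact (gaussSum_congr h k).symm.trans hs
  | coe a =>
    rw [hasSignature_coe_iff] at hs ⊢
    rwa [← gaussSum_congr h]

theorem HasSignature.sum {L M : TwoLinking.{u}} {k : ℕ+} {s t : WithTop (ZMod 8)}
    (hs : L.HasSignature k s) (ht : M.HasSignature k t) : (L.sum M).HasSignature k (s + t) := by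
  induction s with
  | top =>
    rw [WithTop.top_add, hasSignature_top_iff, gaussSum_sum, (hasSignature_top_iff _ _).mp hs, zero_mul]
  | coe a =>
    induction t with
    | top =>
      rw [WithTop.add_top, hasSignature_top_iff, gaussSum_sum, (hasSignature_top_iff _ _).mp ht, mul_zero]
    | coe b =>
      rw [← WithTop.coe_add]
      rw [hasSignature_coe_iff] at hs ht ⊢
      rw [gaussSum_sum, AddChar.map_add_eq_mul, ← hs.2, ← ht.2, norm_mul]
      refine ⟨mul_ne_zero hs.1 ht.1, ?_⟩
      push_cast
      rw [mul_div_mul_comm]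

theorem hasSignature_trivial (k : ℕ+) : (trivial.{u}).HasSignature k 0 := by
  have h : (trivial.{u}).gaussSum k = 1 := by
    rw [gaussSum_eq]
    have : Unique (trivial.{u}).G := inferInstanceAs (Unique PUnit)
    rw [Fintype.sum_unique, Subsingleton.elim default (0 : (trivial.{u}).G)]
    simp
  refine (hasSignature_coe_iff _ k (0 : ZMod 8)).mpr ?_
  simp [h]

/-- The order and the torsion count fix the absolute value of a nonzero sum, and the signature fixes
its phase. -/
theorem gaussSum_eq_of_hasSignature {L M : TwoLinking.{u}} {k : ℕ+} {s : WithTop (ZMod 8)}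
    (hL : L.HasSignature k s) (hM : M.HasSignature k s)
    (hcard : Fintype.card L.G = Fintype.card M.G)
    (htors : torsionCard L.G k = torsionCard M.G k) : L.gaussSum k = M.gaussSum k := by
  induction s with
  | top => exact Eq.trans hL (Eq.symm hM)
  | coe a =>
    rw [hasSignature_coe_iff] at hL hM
    have h1 : ‖L.gaussSum k‖ = ‖M.gaussSum k‖ := by
      rw [← sq_eq_sq₀ (norm_nonneg _) (norm_nonneg _), norm_gaussSum_sq _ _ hL.1,
        norm_gaussSum_sq _ _ hM.1, hcard, htors]
    have h2 := hL.2.trans hM.2.symm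
    rw [h1] at h2
    have h3 : (‖M.gaussSum k‖ : ℂ) ≠ 0 := by simpa using hM.1
    exact (div_left_inj' h3).mp h2

/-! ### Gauss sums determine the distribution of norms. -/

open Polynomial in
/-- An integer polynomial of degree less than `2 ^ N` which vanishes at `exp(2 π i / 2 ^ j)` for
all `j ≤ N` is zero. -/
theorem polynomial_eq_zero_of_roots (N : ℕ) (P : ℤ[X]) (hdeg : P.natDegree < 2 ^ N)
    (h : ∀ j ≤ N, aeval (Complex.exp (2 * Real.pi * Complex.I / (2 ^ j : ℕ))) P = 0) : P = 0 := by
  have hroot : ∀ ω ∈ nthRootsFinset (2 ^ N) (1 : ℂ), (P.map (Int.castRingHom ℂ)).eval ω = 0 := by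
    intro ω hω
    rw [mem_nthRootsFinset (by positivity)] at hω
    obtain ⟨j, hj, hjω⟩ := (Nat.dvd_prime_pow Nat.prime_two).mp (orderOf_dvd_of_pow_eq_one hω)
    have hprim : IsPrimitiveRoot ω (2 ^ j) := hjω ▸ IsPrimitiveRoot.orderOf ω
    have hζ := Complex.isPrimitiveRoot_exp (2 ^ j) (by positivity)
    -- One primitive `2 ^ j`-th root suffices: its minimal polynomial is cyclotomic, so all its
    -- conjugates are roots as well. Together they give `2 ^ N` roots.
    have hdvd : cyclotomic (2 ^ j) ℤ ∣ P := by
      rw [cyclotomic_eq_minpoly hζ (by positivity)]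
      exact minpoly.isIntegrallyClosed_dvd (hζ.isIntegral (by positivity)) (h j hj)
    obtain ⟨R, rfl⟩ := hdvd
    rw [Polynomial.map_mul, eval_mul, map_cyclotomic]
    have : (cyclotomic (2 ^ j) ℂ).IsRoot ω := by
      rw [isRoot_cyclotomic_iff]
      exact hprim
    rw [this.eq_zero, zero_mul]
  have hinj : Function.Injective (Int.castRingHom ℂ) := Int.cast_injective
  have hcard : (nthRootsFinset (2 ^ N) (1 : ℂ)).card = 2 ^ N :=
    (Complex.isPrimitiveRoot_exp (2 ^ N) (by positivity)).card_nthRootsFinset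
  have h0 := eq_zero_of_natDegree_lt_card_of_eval_eq_zero' (P.map (Int.castRingHom ℂ)) _ hroot
    (by rw [hcard]; exact natDegree_map_le.trans_lt hdeg)
  exact (Polynomial.map_eq_zero_iff hinj).mp h0

theorem expChar_fr (N : ℕ) (m : ℕ) :
    expChar (fr N m) = Complex.exp (2 * Real.pi * Complex.I / (2 ^ N : ℕ)) ^ m := by
  rw [fr_apply, expChar_coe, ← Complex.exp_nat_mul]
  congr 1
  push_cast
  ring

/-- Pairings with the same Gauss sums have the same distribution of values `λ(x, x)`. -/
theorem exists_equiv_of_gaussSum_eq {L M : TwoLinking.{u}}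
    (h : ∀ k, L.gaussSum k = M.gaussSum k) :
    ∃ τ : L.G ≃ M.G, ∀ x, M.form (τ x) (τ x) = L.form x x := by
  classical
  obtain ⟨N₁, hN₁⟩ := L.two_group
  obtain ⟨N₂, hN₂⟩ := M.two_group
  set N := max N₁ N₂
  have kill : ∀ (K : TwoLinking.{u}) (n : ℕ), Fintype.card K.G = 2 ^ n → n ≤ N → ∀ x : K.G,
      ∃ m : ℕ, m < 2 ^ N ∧ K.form x x = fr N m := by
    intro K n hn hle x
    have h1 : 2 ^ N • K.form x x = 0 := by
      rw [nsmul_form]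
      have : 2 ^ N • x = 0 := by
        obtain ⟨c, hc⟩ := pow_dvd_pow 2 hle
        rw [hc, ← hn, mul_comm, mul_smul, card_nsmul_eq_zero, smul_zero]
      rw [this]; simp
    obtain ⟨m, hm⟩ := exists_fr N _ h1
    refine ⟨(m % 2 ^ N).toNat, ?_, ?_⟩
    · have := Int.emod_lt_of_pos m (show (0 : ℤ) < 2 ^ N by positivity)
      have h2 := Int.emod_nonneg m (show (2 : ℤ) ^ N ≠ 0 by positivity)
      zify
      rwa [Int.toNat_of_nonneg h2]
    · have h2 := Int.emod_nonneg m (show (2 : ℤ) ^ N ≠ 0 by positivity)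
      rw [hm, Int.toNat_of_nonneg h2, fr_eq_iff]
      exact Int.dvd_self_sub_emod
  choose a ha haL using kill L N₁ hN₁ (le_max_left _ _)
  choose b hb hbM using kill M N₂ hN₂ (le_max_right _ _)
  -- The difference of the generating polynomials of the norms, whose coefficients compare the
  -- numbers of occurrences.
  let P : Polynomial ℤ := ∑ x, Polynomial.X ^ a x - ∑ x, Polynomial.X ^ b x
  have hP : P = 0 := by
    refine polynomial_eq_zero_of_roots N P ?_ fun j hj => ?_
    · have hN : 0 < 2 ^ N := by positivity
      refine lt_of_le_of_lt (Polynomial.natDegree_sub_le _ _) (max_lt ?_ ?_)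
      · refine lt_of_le_of_lt (Polynomial.natDegree_sum_le _ _) ?_
        rw [Finset.fold_max_lt]
        exact ⟨hN, fun x _ => by simpa using ha x⟩
      · refine lt_of_le_of_lt (Polynomial.natDegree_sum_le _ _) ?_
        rw [Finset.fold_max_lt]
        exact ⟨hN, fun x _ => by simpa using hb x⟩
    -- At index `N - j + 1` the Gauss sum scales norms by `2 ^ (N - j)`, which evaluates the
    -- generating polynomial at `exp(2 π i / 2 ^ j)`.
    · have h1 := h (Nat.succPNat (N - j))
      have hfr : ∀ m : ℕ, 2 ^ (N - j) • fr N m = fr j m := fun m => by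
        rw [fr_apply, fr_apply, ← AddCircle.coe_nsmul]
        congr 1
        have : (2 : ℚ) ^ N = 2 ^ (N - j) * 2 ^ j := by rw [← pow_add]; congr 1; lia
        rw [this, nsmul_eq_mul]
        push_cast
        field_simp
      rw [gaussSum_eq, gaussSum_eq] at h1
      simp only [Nat.succPNat_coe, Nat.succ_eq_add_one, Nat.add_sub_cancel, haL, hbM, hfr, expChar_fr] at h1
      simp only [P, map_sub, map_sum, map_pow, Polynomial.aeval_X]
      rw [h1, sub_self]
  have hcoeff : ∀ n, Fintype.card {x // a x = n} = Fintype.card {x // b x = n} := by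
    intro n
    have h1 := congrArg (fun Q => Polynomial.coeff Q n) hP
    simp only [P, Polynomial.coeff_sub, Polynomial.finsetSum_coeff, Polynomial.coeff_X_pow,
      Polynomial.coeff_zero, Finset.sum_boole, sub_eq_zero, Nat.cast_inj] at h1
    rw [Fintype.card_subtype, Fintype.card_subtype]
    simpa only [eq_comm] using h1
  refine ⟨Equiv.ofFiberEquiv (f := a) (g := b) fun n => Fintype.equivOfCardEq (hcoeff n),
    fun x => ?_⟩
  rw [hbM, Equiv.ofFiberEquiv_map (f := a) (g := b), haL]

/-! ### Homogeneous blocks with a given Gram matrix. -/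

/-- The embedding of `ℤ/2^N` in `ℚ/ℤ`. -/
noncomputable def zmodFr (N : ℕ) : ZMod (2 ^ N) →+ AddCircle (1 : ℚ) :=
  ZMod.lift (2 ^ N) ⟨fr N, by rw [fr_eq_zero_iff]; push_cast; rfl⟩

theorem zmodFr_intCast (N : ℕ) (m : ℤ) : zmodFr N m = fr N m := ZMod.lift_coe _ _ _

theorem zmodFr_eq_zero_iff (N : ℕ) (z : ZMod (2 ^ N)) : zmodFr N z = 0 ↔ z = 0 := by
  obtain ⟨m, rfl⟩ := ZMod.intCast_surjective z
  rw [zmodFr_intCast, fr_eq_zero_iff, ZMod.intCast_zmod_eq_zero_iff_dvd]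
  push_cast
  rfl

theorem exists_zmodFr (N : ℕ) (a : AddCircle (1 : ℚ)) (h : 2 ^ N • a = 0) :
    ∃ z, zmodFr N z = a := by
  obtain ⟨m, rfl⟩ := exists_fr N a h
  exact ⟨m, zmodFr_intCast N m⟩

theorem zmodFr_mul (N : ℕ) (z w : ZMod (2 ^ N)) : zmodFr N (z * w) = z.val • zmodFr N w := by
  rw [← map_nsmul, nsmul_eq_mul, ZMod.natCast_zmod_val]

theorem two_pow_nsmul_zmod (N : ℕ) (z : ZMod (2 ^ N)) : 2 ^ N • z = 0 := by
  rw [nsmul_eq_mul, ZMod.natCast_self, zero_mul]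

theorem exists_eq_nsmul_zmod {N k : ℕ} (hk : k ≤ N) (z : ZMod (2 ^ N)) (hz : 2 ^ k • z = 0) :
    ∃ w : ZMod (2 ^ N), z = 2 ^ (N - k) • w := by
  obtain ⟨m, rfl⟩ := ZMod.intCast_surjective z
  rw [nsmul_eq_mul] at hz
  have h3 : (((2 ^ k : ℕ) * m : ℤ) : ZMod (2 ^ N)) = 0 := by push_cast at hz ⊢; exact hz
  rw [ZMod.intCast_zmod_eq_zero_iff_dvd] at h3
  have h4 : (2 : ℤ) ^ N = 2 ^ k * 2 ^ (N - k) := by rw [← pow_add]; congr 1; lia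
  push_cast at h3
  rw [h4, mul_dvd_mul_iff_left (by positivity)] at h3
  obtain ⟨c, rfl⟩ := h3
  refine ⟨c, ?_⟩
  rw [nsmul_eq_mul]
  push_cast
  rfl

/-- The form with a given Gram matrix on `(ℤ/2^N)^r`. -/
noncomputable def gramForm (N r : ℕ) (A : Matrix (Fin r) (Fin r) (ZMod (2 ^ N))) :
    (Fin r → ZMod (2 ^ N)) →+ (Fin r → ZMod (2 ^ N)) →+ AddCircle (1 : ℚ) where
  toFun v :=
    { toFun := fun w => zmodFr N (v ⬝ᵥ A.mulVec w)
      map_zero' := by simp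
      map_add' := fun w w' => by rw [Matrix.mulVec_add, dotProduct_add, map_add] }
  map_zero' := AddMonoidHom.ext fun w => by simp
  map_add' v v' := AddMonoidHom.ext fun w =>
    (congrArg (zmodFr N) (add_dotProduct v v' (A.mulVec w))).trans (map_add (zmodFr N) _ _)

theorem gramForm_apply (N r : ℕ) (A : Matrix (Fin r) (Fin r) (ZMod (2 ^ N)))
    (v w : Fin r → ZMod (2 ^ N)) : gramForm N r A v w = zmodFr N (v ⬝ᵥ A.mulVec w) := rfl

theorem gramForm_bijective {N r : ℕ} {A : Matrix (Fin r) (Fin r) (ZMod (2 ^ N))}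
    (hA : IsUnit A.det) : Function.Bijective (gramForm N r A) := by
  constructor
  · rw [injective_iff_map_eq_zero]
    intro v hv
    have h1 : ∀ w, Matrix.vecMul v A ⬝ᵥ w = 0 := fun w => by
      rw [← Matrix.dotProduct_mulVec, ← zmodFr_eq_zero_iff]
      exact DFunLike.congr_fun hv w
    have h2 : Matrix.vecMul v A = 0 := dotProduct_eq_zero _ h1
    have h3 : Matrix.vecMul (Matrix.vecMul v A) A⁻¹ = v := by
      rw [Matrix.vecMul_vecMul, Matrix.mul_nonsing_inv _ hA, Matrix.vecMul_one]
    rw [← h3, h2, Matrix.zero_vecMul]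
  · intro χ
    have h1 : ∀ i, ∃ z, zmodFr N z = χ (Pi.single i 1) := fun i => by
      refine exists_zmodFr N _ ?_
      rw [← map_nsmul]
      convert map_zero χ
      ext j
      exact two_pow_nsmul_zmod N _
    choose c hc using h1
    -- The vector `c` lists the values of `χ` on the standard basis; the inverse Gram matrix
    -- converts it into the representing element.
    refine ⟨Matrix.vecMul c A⁻¹, ?_⟩
    refine AddMonoidHom.ext fun w => ?_
    rw [gramForm_apply, Matrix.dotProduct_mulVec, Matrix.vecMul_vecMul,
      Matrix.nonsing_inv_mul _ hA, Matrix.vecMul_one]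
    conv_rhs => rw [← Finset.univ_sum_single w]
    rw [dotProduct, map_sum, map_sum]
    refine Finset.sum_congr rfl fun i _ => ?_
    rw [mul_comm, zmodFr_mul, hc, ← map_nsmul]
    congr 1
    rw [← Pi.single_smul, nsmul_eq_mul, ZMod.natCast_zmod_val, mul_one]

/-- The linking pairing on `(ℤ/2^N)^r` with an invertible Gram matrix. -/
noncomputable def block (N r : ℕ) (A : Matrix (Fin r) (Fin r) (ZMod (2 ^ N))) (hs : A.IsSymm)
    (hA : IsUnit A.det) : TwoLinking.{u} where
  G := ULift.{u} (Fin r → ZMod (2 ^ N))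
  form := ((AddMonoidHom.compHom.flip
    (AddEquiv.ulift (α := Fin r → ZMod (2 ^ N))).toAddMonoidHom).comp
      (gramForm N r A)).comp (AddEquiv.ulift (α := Fin r → ZMod (2 ^ N))).toAddMonoidHom
  symm x y := by
    change gramForm N r A x.down y.down = gramForm N r A y.down x.down
    rw [gramForm_apply, gramForm_apply, dotProduct_comm, ← Matrix.vecMul_transpose, hs.eq,
      Matrix.dotProduct_mulVec]
  adjoint_bijective := by
    constructor
    · intro x y h
      have h1 : gramForm N r A x.down = gramForm N r A y.down := by
        exact AddMonoidHom.ext fun w => DFunLike.congr_fun h (ULift.up w)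
      exact ULift.down_injective ((gramForm_bijective hA).1 h1)
    · intro χ
      obtain ⟨v, hv⟩ := (gramForm_bijective hA).2
        (χ.comp (AddEquiv.ulift (α := Fin r → ZMod (2 ^ N))).symm.toAddMonoidHom)
      refine ⟨ULift.up v, ?_⟩
      ext w
      exact DFunLike.congr_fun hv w.down
  two_group := ⟨N * r, by
    rw [Fintype.card_ulift, Fintype.card_fun, ZMod.card, Fintype.card_fin, ← pow_mul]⟩

section block

variable {N r : ℕ} {A : Matrix (Fin r) (Fin r) (ZMod (2 ^ N))} {hs : A.IsSymm}
  {hA : IsUnit A.det}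

theorem block_form (x y : (block.{u} N r A hs hA).G) :
    (block.{u} N r A hs hA).form x y = zmodFr N (x.down ⬝ᵥ A.mulVec y.down) := rfl

theorem two_pow_nsmul_block (x : (block.{u} N r A hs hA).G) : 2 ^ N • x = 0 :=
  ULift.down_injective (funext fun _ => two_pow_nsmul_zmod N _)

/-- Elements of `(ℤ/2^N)^r` killed by `2 ^ k` are divisible by `2 ^ (N - k)`. -/
theorem exists_eq_nsmul_block {k : ℕ} (hk : k ≤ N) (x : (block.{u} N r A hs hA).G)
    (hx : 2 ^ k • x = 0) : ∃ y, x = 2 ^ (N - k) • y := by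
  have h1 : ∀ i, ∃ z : ZMod (2 ^ N), x.down i = 2 ^ (N - k) • z := fun i =>
    exists_eq_nsmul_zmod hk _ (congrFun (congrArg ULift.down hx) i)
  choose z hz using h1
  exact ⟨ULift.up z, ULift.down_injective (funext hz)⟩

/-- For `k < N` the `2 ^ k`-torsion consists of multiples of `2 ^ (N - k)`, whose norms gain the
factor `2 ^ (2 (N - k))`. Together with `2 ^ (k - 1)` this gives exponent `2N - k - 1 ≥ N`. For `k >
N` the factor `2 ^ (k - 1)` already kills the group. Only `k = N` needs the evenness hypothesis. -/
theorem gaussSum_block_ne_zero (k : ℕ+)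
    (h : (k : ℕ) ≠ N ∨ ∀ x : (block.{u} N r A hs hA).G,
      2 ^ ((k : ℕ) - 1) • (block.{u} N r A hs hA).form x x = 0) :
    (block.{u} N r A hs hA).gaussSum k ≠ 0 := by
  rw [gaussSum_ne_zero_iff]
  intro z hz
  rcases h with h | h
  · have hk := k.pos
    rcases lt_or_gt_of_ne h with h | h
    · obtain ⟨y, rfl⟩ := exists_eq_nsmul_block h.le z hz
      rw [map_nsmul, nsmul_form]
      have h2 : 2 ^ ((k : ℕ) - 1) • 2 ^ (N - k) • 2 ^ (N - k) • y = 0 := by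
        rw [← mul_smul, ← mul_smul, ← pow_add, ← pow_add]
        have : (k : ℕ) - 1 + (N - k) + (N - k) = (N - k - 1) + N := by lia
        rw [this, pow_add, mul_smul, two_pow_nsmul_block, smul_zero]
      have h3 : 2 ^ ((k : ℕ) - 1) • (2 ^ (N - k) •
          (block.{u} N r A hs hA).form (2 ^ (N - k) • y) y) =
          (block.{u} N r A hs hA).form (2 ^ ((k : ℕ) - 1) • 2 ^ (N - k) • 2 ^ (N - k) • y) y := by
        simp only [map_nsmul, AddMonoidHom.nsmul_apply]
      rw [← nsmul_form, h3, h2]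
      simp
    · rw [nsmul_form]
      have : (k : ℕ) - 1 = ((k : ℕ) - 1 - N) + N := by lia
      rw [this, pow_add, mul_smul, two_pow_nsmul_block]
      simp
  · exact h z

/-- A family of elements with prescribed Gram matrix defines a map from a block. -/
theorem exists_hom_block {N r : ℕ} {A : Matrix (Fin r) (Fin r) (ZMod (2 ^ N))} (hs : A.IsSymm)
    (hA : IsUnit A.det) (L : TwoLinking.{u}) (x : Fin r → L.G) (hx : ∀ i, 2 ^ N • x i = 0)
    (hform : ∀ i j, L.form (x i) (x j) = zmodFr N (A i j)) :
    ∃ f : (block.{u} N r A hs hA).G →+ L.G,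
      (∀ v w, L.form (f v) (f w) = (block.{u} N r A hs hA).form v w) ∧
      ∀ i, f (ULift.up (Pi.single i 1)) = x i := by
  let g : Fin r → ZMod (2 ^ N) →+ L.G := fun i =>
    ZMod.lift (2 ^ N) ⟨zmultiplesHom L.G (x i), by
      rw [zmultiplesHom_apply, natCast_zsmul]; exact hx i⟩
  have hg : ∀ i z, g i z = z.val • x i := fun i z => by
    conv_lhs => rw [← ZMod.natCast_zmod_val z, ← Int.cast_natCast]
    refine (ZMod.lift_coe _ _ _).trans ?_
    rw [zmultiplesHom_apply, natCast_zsmul]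
  let f : (block.{u} N r A hs hA).G →+ L.G :=
    { toFun := fun v => ∑ i, g i (v.down i)
      map_zero' := by
        refine Finset.sum_eq_zero fun i _ => ?_
        exact map_zero _
      map_add' := fun v w => by
        rw [← Finset.sum_add_distrib]
        exact Finset.sum_congr rfl fun i _ => map_add _ _ _ }
  have hf : ∀ v, f v = ∑ i, (v.down i).val • x i := fun v =>
    (show f v = ∑ i, g i (v.down i) from rfl).trans (Finset.sum_congr rfl fun i _ => hg i _)
  refine ⟨f, fun v w => ?_, fun i => ?_⟩
  · rw [hf, hf, block_form]
    simp only [map_sum, AddMonoidHom.finsetSum_apply, map_nsmul, AddMonoidHom.nsmul_apply, hform,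
      dotProduct, Matrix.mulVec, Finset.mul_sum]
    rw [Finset.sum_comm]
    refine Finset.sum_congr rfl fun i _ => ?_
    rw [Finset.smul_sum]
    refine Finset.sum_congr rfl fun j _ => ?_
    rw [zmodFr_mul, mul_comm, zmodFr_mul, smul_comm]
  · change ∑ j, g j ((Pi.single i 1 : Fin r → ZMod (2 ^ N)) j) = x i
    rw [Finset.sum_eq_single i]
    · rw [Pi.single_eq_same]
      have : g i ((1 : ℤ) : ZMod (2 ^ N)) = x i := by
        refine (ZMod.lift_coe _ _ _).trans ?_
        simp
      simpa using this
    · intro j _ hj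
      rw [Pi.single_eq_of_ne hj, map_zero]
    · simp

end block

/-! ### Orthogonal complements. -/

/-- A form-preserving map from a linking pairing embeds it as an orthogonal summand. -/
theorem exists_orthogonal_complement {B L : TwoLinking.{u}} (f : B.G →+ L.G)
    (hf : ∀ x y, L.form (f x) (f y) = B.form x y) :
    ∃ (L' : TwoLinking.{u}) (e : B.G × L'.G ≃+ L.G),
      (∀ p q, L.form (e p) (e q) = B.form p.1 q.1 + L'.form p.2 q.2) ∧ ∀ b, e (b, 0) = f b := by
  classical
  let K : AddSubgroup L.G :=
    { carrier := {y | ∀ b, L.form (f b) y = 0}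
      zero_mem' := fun b => map_zero _
      add_mem' := fun {y z} hy hz b => by rw [map_add, hy b, hz b, add_zero]
      neg_mem' := fun {y} hy b => by rw [map_neg, hy b, neg_zero] }
  have hK : ∀ (y : K) b, L.form (f b) y = 0 := fun y => y.2
  let g : B.G × K →+ L.G := f.coprod K.subtype
  have hg : ∀ p, g p = f p.1 + p.2 := fun p => rfl
  have hinj : Function.Injective g := by
    rw [injective_iff_map_eq_zero]
    rintro ⟨b, y⟩ h
    rw [hg] at h
    have hb : b = 0 := B.form_eq_zero fun b' => by
      have h1 : L.form (f b') (f b + y) = 0 := by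
        have h' : f b + (y : L.G) = 0 := h
        rw [h', map_zero]
      rw [map_add, hK y b', add_zero, hf] at h1
      rw [B.symm, h1]
    subst hb
    simp only [map_zero, zero_add] at h
    exact Prod.ext rfl (Subtype.ext h)
  have hsurj : Function.Surjective g := by
    intro z
    -- Orthogonal projection: `b` represents the functional of `z` on the image of `f`, so `z - f b`
    -- is orthogonal to that image.
    obtain ⟨b, hb⟩ := B.adjoint_bijective.2 ((L.form z).comp f)
    have hb' : ∀ b', B.form b b' = L.form z (f b') := fun b' => DFunLike.congr_fun hb b'
    refine ⟨(b, ⟨z - f b, fun b' => ?_⟩), ?_⟩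
    · rw [map_sub, hf, B.symm, hb', L.symm, sub_self]
    · rw [hg]; exact add_sub_cancel _ _
  let e : B.G × K ≃+ L.G := AddEquiv.ofBijective g ⟨hinj, hsurj⟩
  have he : ∀ p, e p = f p.1 + p.2 := hg
  let form' : K →+ K →+ AddCircle (1 : ℚ) :=
    (AddMonoidHom.compHom.flip K.subtype).comp (L.form.comp K.subtype)
  have hform' : ∀ x y, form' x y = L.form x y := fun x y => rfl
  have hsum : ∀ p q, L.form (e p) (e q) = B.form p.1 q.1 + form' p.2 q.2 := by
    intro p q
    rw [he, he, hform']
    simp only [map_add, AddMonoidHom.add_apply, hf, hK, L.symm p.2 (f q.1), zero_add, add_zero]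
  let L' : TwoLinking.{u} :=
    { G := K
      fin := Fintype.ofFinite K
      form := form'
      symm := fun x y => L.symm _ _
      adjoint_bijective := by
        constructor
        · rw [injective_iff_map_eq_zero]
          intro y hy
          have : e (0, y) = 0 := L.form_eq_zero fun z => by
            obtain ⟨q, rfl⟩ := e.surjective z
            rw [hsum, hy]
            simp
          simpa using this
        · intro χ
          obtain ⟨z, hz⟩ := L.adjoint_bijective.2
            ((χ.comp (AddMonoidHom.snd B.G K)).comp e.symm.toAddMonoidHom)
          obtain ⟨p, rfl⟩ := e.surjective z
          refine ⟨p.2, ?_⟩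
          ext y
          have h1 := DFunLike.congr_fun hz (e (0, y))
          rw [hsum] at h1
          simpa using h1
      two_group := by
        obtain ⟨n, hn⟩ := L.two_group
        have h1 : Nat.card K ∣ 2 ^ n := by
          rw [← hn, ← Nat.card_eq_fintype_card]
          exact AddSubgroup.card_addSubgroup_dvd_card K
        obtain ⟨m, -, hm⟩ := (Nat.dvd_prime_pow Nat.prime_two).mp h1
        exact ⟨m, by rw [← hm, ← @Nat.card_eq_fintype_card K (Fintype.ofFinite K)]⟩ }
  exact ⟨L', e, hsum, fun b => by rw [he]; exact add_zero _⟩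

/-! ### Torsion counts and the exponent. -/

theorem torsionCard_congr {A B : Type*} [AddCommGroup A] [AddCommGroup B] (e : A ≃+ B) (k : ℕ) :
    torsionCard A k = torsionCard B k :=
  Nat.card_congr (e.toEquiv.subtypeEquiv fun x => by
    rw [← e.map_eq_zero_iff, map_nsmul]; rfl)

theorem torsionCard_prod (A B : Type*) [AddCommGroup A] [AddCommGroup B] (k : ℕ) :
    torsionCard (A × B) k = torsionCard A k * torsionCard B k := by
  rw [torsionCard, torsionCard, torsionCard, ← Nat.card_prod]
  refine Nat.card_congr ?_
  refine (Equiv.subtypeEquivRight fun x => ?_).trans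
    (Equiv.subtypeProdEquivProd (p := fun x : A => 2 ^ k • x = 0)
      (q := fun x : B => 2 ^ k • x = 0))
  rw [Prod.ext_iff]; rfl

theorem torsionCard_pos (A : Type*) [AddCommGroup A] [Finite A] (k : ℕ) : 0 < torsionCard A k := by
  have : Nonempty {x : A // 2 ^ k • x = 0} := ⟨⟨0, smul_zero _⟩⟩
  exact Nat.card_pos

theorem exists_exponent (L : TwoLinking.{u}) (h : 1 < Fintype.card L.G) :
    ∃ n, (∀ x : L.G, 2 ^ (n + 1) • x = 0) ∧ ∃ x : L.G, 2 ^ n • x ≠ 0 := by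
  classical
  obtain ⟨a, ha⟩ := L.two_group
  have hex : ∃ N, ∀ x : L.G, 2 ^ N • x = 0 := ⟨a, fun x => by
    rw [← ha, card_nsmul_eq_zero]⟩
  have h0 : Nat.find hex ≠ 0 := fun h0 => by
    have h1 := Nat.find_spec hex
    rw [h0] at h1
    obtain ⟨x, y, hxy⟩ := Fintype.one_lt_card_iff.mp h
    have hx := h1 x
    have hy := h1 y
    simp only [pow_zero, one_smul] at hx hy
    exact hxy (hx.trans hy.symm)
  obtain ⟨n, hn⟩ := Nat.exists_eq_succ_of_ne_zero h0
  refine ⟨n, ?_, ?_⟩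
  · have h1 := Nat.find_spec hex
    rw [hn] at h1
    exact h1
  · have h1 := Nat.find_min hex (m := n) (by lia)
    push Not at h1
    exact h1

/-! ### Vectors of maximal order and binary summands. -/

section vectors

variable {L : TwoLinking.{u}} {n : ℕ}

theorem exists_form_fr (hL : ∀ x : L.G, 2 ^ (n + 1) • x = 0) (x y : L.G) :
    ∃ m : ℤ, L.form x y = fr (n + 1) m :=
  exists_fr _ _ (by rw [nsmul_form, hL]; simp)

theorem nsmul_ne_zero_of_form {x y : L.G} {m : ℤ} (h : L.form x y = fr (n + 1) m)
    (hm : Odd m) : 2 ^ n • x ≠ 0 := fun hx => by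
  have h1 : 2 ^ n • fr (n + 1) m = 0 := by rw [← h, nsmul_form, hx]; simp
  rw [two_pow_nsmul_fr_eq_zero_iff] at h1
  exact Int.not_even_iff_odd.mpr hm (even_iff_two_dvd.mpr h1)

/-- Nondegeneracy applied to `2 ^ n • x` yields a partner with odd numerator, which is invertible
modulo `2 ^ (n + 1)` and can be scaled to one. -/
theorem exists_form_eq_fr_one (hL : ∀ x : L.G, 2 ^ (n + 1) • x = 0) {x : L.G}
    (hx : 2 ^ n • x ≠ 0) : ∃ y, L.form x y = fr (n + 1) 1 := by
  obtain ⟨y, hy⟩ := L.exists_form_ne_zero hx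
  obtain ⟨m, hm⟩ := exists_form_fr hL x y
  rw [← nsmul_form, hm, Ne, two_pow_nsmul_fr_eq_zero_iff, ← even_iff_two_dvd,
    Int.not_even_iff_odd] at hy
  have hc : IsCoprime m (2 ^ (n + 1)) := by
    refine IsCoprime.pow_right ?_
    obtain ⟨k, rfl⟩ := hy
    exact ⟨1, -k, by ring⟩
  obtain ⟨a, b, hab⟩ := hc
  refine ⟨a • y, ?_⟩
  rw [map_zsmul, hm, zsmul_fr, fr_eq_iff]
  exact ⟨-b, by linear_combination hab⟩

/-- Solvability of quadratic congruences modulo powers of two with odd linear coefficient. -/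
theorem exists_quadratic_root (b c t : ℤ) (hb : Odd b) (ht : Even t) (j : ℕ) :
    ∃ α : ℤ, (2 : ℤ) ^ j ∣ t + b * α + c * α ^ 2 := by
  suffices h : ∃ α : ℤ, (2 : ℤ) ^ (j + 1) ∣ t + b * α + c * α ^ 2 by
    obtain ⟨α, hα⟩ := h
    exact ⟨α, (pow_dvd_pow 2 (Nat.le_succ j)).trans hα⟩
  induction j with
  | zero => exact ⟨0, by simpa using even_iff_two_dvd.mp ht⟩
  | succ j ih =>
    obtain ⟨α, d, hd⟩ := ih
    obtain ⟨e, rfl⟩ := hb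
    -- Hensel lifting: as `b` is odd, the correction changes the value by `d * 2 ^ (j + 1)` modulo
    -- `2 ^ (j + 2)`, cancelling the error up to an even multiple.
    refine ⟨α + d * 2 ^ (j + 1), d * (e + 1 + α * c + c * d * 2 ^ j), ?_⟩
    have h1 : (2 : ℤ) ^ (j + 1 + 1) = 2 * 2 ^ (j + 1) := by ring
    have h2 : (2 : ℤ) ^ (j + 1) = 2 * 2 ^ j := by ring
    rw [h1]
    linear_combination hd + (c * d ^ 2 * 2 ^ (j + 1)) * h2

theorem form_comb {N : ℕ} {x y : L.G} {a m c : ℤ} (hxx : L.form x x = fr N a)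
    (hxy : L.form x y = fr N m) (hyy : L.form y y = fr N c) (α β γ δ : ℤ) :
    L.form (α • x + β • y) (γ • x + δ • y) =
      fr N (α * γ * a + (α * δ + β * γ) * m + β * δ * c) := by
  simp only [map_add, map_zsmul, AddMonoidHom.add_apply, AddMonoidHom.zsmul_apply, hxx, hxy, hyy,
    L.symm y x, zsmul_fr]
  simp only [← map_add, zsmul_fr]
  congr 1
  ring

theorem exists_form_self_eq_fr_two_mul (hL : ∀ x : L.G, 2 ^ (n + 1) • x = 0)
    (heven : ∀ x, 2 ^ n • L.form x x = 0) (x : L.G) :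
    ∃ u : ℤ, L.form x x = fr (n + 1) (2 * u) := by
  obtain ⟨m, hm⟩ := exists_form_fr hL x x
  have h1 := heven x
  rw [hm, two_pow_nsmul_fr_eq_zero_iff] at h1
  obtain ⟨u, rfl⟩ := h1
  exact ⟨u, hm⟩

theorem fr_two_mul_eq_of_dvd {a b : ℤ} (h : (2 : ℤ) ^ n ∣ a - b) :
    fr (n + 1) (2 * a) = fr (n + 1) (2 * b) := by
  rw [fr_eq_iff, ← mul_sub, pow_succ, mul_comm]
  exact mul_dvd_mul_left 2 h

/-- An isotropic vector of maximal order is part of a hyperbolic pair. -/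
theorem exists_hyperbolic_pair (hL : ∀ x : L.G, 2 ^ (n + 1) • x = 0)
    (heven : ∀ x, 2 ^ n • L.form x x = 0) {x : L.G} (hx : 2 ^ n • x ≠ 0)
    (hxx : L.form x x = 0) :
    ∃ y, L.form x y = fr (n + 1) 1 ∧ L.form y y = 0 := by
  obtain ⟨y, hy⟩ := exists_form_eq_fr_one hL hx
  obtain ⟨c, hc⟩ := exists_form_self_eq_fr_two_mul hL heven y
  have hxx' : L.form x x = fr (n + 1) 0 := by rw [hxx, map_zero]
  -- Subtracting `c • x` keeps the pairing with the isotropic `x` and lowers the numerator `2 c` of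
  -- the norm to zero.
  refine ⟨(-c) • x + (1 : ℤ) • y, ?_, ?_⟩
  · have h := form_comb hxx' hy hc 1 0 (-c) 1
    simp only [one_smul, zero_smul, add_zero] at h ⊢
    rw [h]
    congr 1
    ring
  · rw [form_comb hxx' hy hc, fr_eq_zero_iff]
    ring_nf
    exact dvd_zero _

/-- Without isotropic vectors of maximal order, all vectors of maximal order have norm
twice an odd number. -/
theorem odd_of_anisotropic (hL : ∀ x : L.G, 2 ^ (n + 1) • x = 0)
    (heven : ∀ x, 2 ^ n • L.form x x = 0)
    (hani : ∀ x : L.G, 2 ^ n • x ≠ 0 → L.form x x ≠ 0) {z : L.G} (hz : 2 ^ n • z ≠ 0) {b : ℤ}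
    (hzz : L.form z z = fr (n + 1) (2 * b)) : Odd b := by
  rw [← Int.not_even_iff_odd]
  intro hb
  obtain ⟨y, hy⟩ := exists_form_eq_fr_one hL hz
  obtain ⟨c, hc⟩ := exists_form_self_eq_fr_two_mul hL heven y
  -- The polynomial is half the norm numerator of `z + α • y`. If `b` were even it would have a
  -- root, giving an isotropic vector of maximal order.
  obtain ⟨α, hα⟩ := exists_quadratic_root 1 c b odd_one hb n
  refine hani ((1 : ℤ) • z + α • y) ?_ ?_
  · have h := form_comb hzz hy hc 1 α 0 1
    exact nsmul_ne_zero_of_form h ⟨α * c, by ring⟩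
  · rw [form_comb hzz hy hc]
    have h2 := fr_two_mul_eq_of_dvd (n := n) (a := b + 1 * α + c * α ^ 2) (b := 0)
      (by simpa using hα)
    rw [mul_zero, map_zero] at h2
    rw [← h2]
    congr 1
    ring

/-- All vectors of maximal order have half-norm numerator odd, so each quadratic congruence needed
to normalise it to one has an even constant term and is solvable. -/
theorem exists_anisotropic_pair (hL : ∀ x : L.G, 2 ^ (n + 1) • x = 0)
    (heven : ∀ x, 2 ^ n • L.form x x = 0)
    (hani : ∀ x : L.G, 2 ^ n • x ≠ 0 → L.form x x ≠ 0) (htop : ∃ x : L.G, 2 ^ n • x ≠ 0) :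
    ∃ x y, L.form x x = fr (n + 1) 2 ∧ L.form x y = fr (n + 1) 1 ∧
      L.form y y = fr (n + 1) 2 := by
  obtain ⟨x, hx⟩ := htop
  obtain ⟨y, hy⟩ := exists_form_eq_fr_one hL hx
  obtain ⟨u, hu⟩ := exists_form_self_eq_fr_two_mul hL heven x
  obtain ⟨w, hw⟩ := exists_form_self_eq_fr_two_mul hL heven y
  have hytop : 2 ^ n • y ≠ 0 := nsmul_ne_zero_of_form (by rw [L.symm, hy]) odd_one
  have hwodd := odd_of_anisotropic hL heven hani hytop hw
  obtain ⟨α, hα⟩ := exists_quadratic_root 1 u (w - 1) odd_one (hwodd.sub_odd odd_one) n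
  set x₁ := α • x + (1 : ℤ) • y with hx₁
  have hx₁x₁ : L.form x₁ x₁ = fr (n + 1) (2 * 1) := by
    rw [form_comb hu hy hw, ← fr_two_mul_eq_of_dvd (n := n) (a := w + 1 * α + u * α ^ 2) (b := 1)
      (by convert hα using 1; ring)]
    congr 1
    ring
  have hx₁top : 2 ^ n • x₁ ≠ 0 := by
    have h := form_comb hu hy hw α 1 1 0
    exact nsmul_ne_zero_of_form h ⟨α * u, by ring⟩
  obtain ⟨y₁, hy₁⟩ := exists_form_eq_fr_one hL hx₁top
  obtain ⟨w₁, hw₁⟩ := exists_form_self_eq_fr_two_mul hL heven y₁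
  have hy₁top : 2 ^ n • y₁ ≠ 0 := nsmul_ne_zero_of_form (by rw [L.symm, hy₁]) odd_one
  have hw₁odd := odd_of_anisotropic hL heven hani hy₁top hw₁
  -- The combination `β • x₁ + (1 - 2 * β) • y₁` always pairs to one with `x₁`, since `2 * β + (1 -
  -- 2 * β) = 1`; `β` is chosen to make its half-norm numerator one.
  obtain ⟨β, hβ⟩ := exists_quadratic_root (1 - 4 * w₁) (4 * w₁ - 1) (w₁ - 1)
    ⟨-2 * w₁, by ring⟩ (hw₁odd.sub_odd odd_one) n
  refine ⟨x₁, β • x₁ + (1 - 2 * β) • y₁, by rw [hx₁x₁, mul_one], ?_, ?_⟩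
  · have h := form_comb hx₁x₁ hy₁ hw₁ 1 0 β (1 - 2 * β)
    simp only [one_smul, zero_smul, add_zero] at h
    rw [h]
    congr 1
    ring
  · rw [form_comb hx₁x₁ hy₁ hw₁, ← mul_one (2 : ℤ), ← fr_two_mul_eq_of_dvd (n := n)
      (a := w₁ + (1 - 4 * w₁) * β + (4 * w₁ - 1) * β ^ 2) (b := 1) (by convert hβ using 1; ring)]
    congr 1
    ring

end vectors

/-! ### Counting norms: isotropic against anisotropic. -/

theorem card_torsion_mul_index (A : Type*) [AddCommGroup A] [Finite A] (k : ℕ) :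
    torsionCard A k * (torsionSubgroup A k).index = Nat.card A :=
  (torsionSubgroup A k).card_mul_index

theorem torsionCard_eq_card_iff (A : Type*) [AddCommGroup A] [Finite A] (k : ℕ) :
    torsionCard A k = Nat.card A ↔ ∀ x : A, 2 ^ k • x = 0 := by
  constructor
  · intro h x
    have h1 : torsionSubgroup A k = ⊤ := AddSubgroup.eq_top_of_card_eq _ h
    have h2 : x ∈ torsionSubgroup A k := h1 ▸ AddSubgroup.mem_top x
    exact h2
  · intro h
    exact Nat.card_congr (Equiv.subtypeUnivEquiv h)

theorem exists_index_eq_two_pow (L : TwoLinking.{u}) (k : ℕ) :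
    ∃ i, (torsionSubgroup L.G k).index = 2 ^ i := by
  obtain ⟨a, ha⟩ := L.two_group
  have h : (torsionSubgroup L.G k).index ∣ 2 ^ a := by
    rw [← ha, ← Nat.card_eq_fintype_card]
    exact AddSubgroup.index_dvd_card _
  obtain ⟨i, -, hi⟩ := (Nat.dvd_prime_pow Nat.prime_two).mp h
  exact ⟨i, hi⟩

section isotropic

variable {L : TwoLinking.{u}} {m : ℕ}

/-- Put `q z = 2 ^ m λ(z, z)` and `b z = 2 ^ (m + 1) λ(z, x)`, so `q (z + x) = q z + b z`.
Translation by `y` shows that `b` is nonzero on at least half of `G`, and there translation by `x`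
makes `q` vanish at least half the time. Since `q 0 = b 0 = 0`, the bound of one quarter is strict.
-/
theorem card_lt_of_isotropic (hL : ∀ x : L.G, 2 ^ (m + 2) • x = 0)
    (heven : ∀ x, 2 ^ (m + 1) • L.form x x = 0) {x : L.G} (hx : 2 ^ (m + 1) • x ≠ 0)
    (hxx : L.form x x = 0) :
    Nat.card L.G < 4 * Nat.card {z : L.G // 2 ^ m • L.form z z = 0} := by
  classical
  obtain ⟨y, hy⟩ := exists_form_eq_fr_one hL hx
  let b : L.G → AddCircle (1 : ℚ) := fun z => 2 ^ (m + 1) • L.form z x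
  let q : L.G → AddCircle (1 : ℚ) := fun z => 2 ^ m • L.form z z
  have hb2 : ∀ z, 2 • b z = 0 := fun z => by
    simp only [b]
    rw [← mul_nsmul', ← pow_succ', nsmul_form, hL]; simp
  have hq2 : ∀ z, 2 • q z = 0 := fun z => by
    simp only [q]
    rw [← mul_nsmul', ← pow_succ', heven]
  have hbadd : ∀ z w, b (z + w) = b z + b w := fun z w => by
    simp only [b, map_add, AddMonoidHom.add_apply, nsmul_add]
  have hqx : ∀ z, q (z + x) = q z + b z := fun z => by
    simp only [q, b]
    rw [form_add_self, hxx, add_zero, nsmul_add, ← mul_nsmul', ← pow_succ]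
  have hbx : b x = 0 := by simp only [b, hxx, smul_zero]
  have hby : b y ≠ 0 := by
    simp only [b]
    rw [L.symm, hy, Ne, two_pow_nsmul_fr_eq_zero_iff]
    decide
  let T := Finset.univ.filter fun z => b z ≠ 0
  let Z := Finset.univ.filter fun z => q z = 0
  have h1 : (Finset.univ.filter fun z => ¬ b z ≠ 0).card ≤ T.card := by
    refine Finset.card_le_card_of_injOn (· + y) ?_ (add_left_injective y).injOn
    intro z hz
    simp only [T, Finset.coe_filter, Finset.mem_univ, true_and, Set.mem_ofPred_eq, not_not]
      at hz ⊢
    rw [hbadd, hz, zero_add]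
    exact hby
  have h2 : (T.filter fun z => ¬ q z = 0).card ≤ (T.filter fun z => q z = 0).card := by
    refine Finset.card_le_card_of_injOn (· + x) ?_ (add_left_injective x).injOn
    intro z hz
    simp only [T, Finset.coe_filter, Finset.mem_filter, Finset.mem_univ, true_and,
      Set.mem_ofPred_eq] at hz ⊢
    refine ⟨by rw [hbadd, hbx, add_zero]; exact hz.1, ?_⟩
    rw [hqx, eq_of_two_nsmul (hb2 z) (hq2 z) hz.1 hz.2, ← two_nsmul, hq2]
  have h3 : (T.filter fun z => q z = 0).card < Z.card := by
    refine Finset.card_lt_card ((Finset.ssubset_iff_of_subset ?_).mpr ⟨0, ?_, ?_⟩)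
    · intro z hz
      simp only [Z, Finset.mem_filter, Finset.mem_univ, true_and] at hz ⊢
      exact hz.2
    · simp [Z, q]
    · simp [T, b]
  have h4 := Finset.card_filter_add_card_filter_not (s := (Finset.univ : Finset L.G))
    (fun z => b z ≠ 0)
  have h5 := Finset.card_filter_add_card_filter_not (s := T) (fun z => q z = 0)
  have h6 : Nat.card {z : L.G // 2 ^ m • L.form z z = 0} = Z.card := by
    rw [Nat.card_eq_fintype_card, Fintype.card_subtype]
  rw [h6, Nat.card_eq_fintype_card, ← Finset.card_univ]
  change T.card + _ = _ at h4
  lia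

/-- A vector of maximal order has norm twice an odd number over `2 ^ (m + 2)`, which `2 ^ m` does
not kill. The zeros thus lie in the `2 ^ (m + 1)`-torsion, a subgroup of index at least four. -/
theorem card_le_of_anisotropic (hL : ∀ x : L.G, 2 ^ (m + 2) • x = 0)
    (heven : ∀ x, 2 ^ (m + 1) • L.form x x = 0)
    (hani : ∀ x : L.G, 2 ^ (m + 1) • x ≠ 0 → L.form x x ≠ 0)
    (htop : ∃ x : L.G, 2 ^ (m + 1) • x ≠ 0) :
    4 * Nat.card {z : L.G // 2 ^ m • L.form z z = 0} ≤ Nat.card L.G := by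
  obtain ⟨x, hx⟩ := htop
  obtain ⟨y, hy⟩ := exists_form_eq_fr_one hL hx
  obtain ⟨u, hu⟩ := exists_form_self_eq_fr_two_mul hL heven x
  obtain ⟨w, hw⟩ := exists_form_self_eq_fr_two_mul hL heven y
  have hytop : 2 ^ (m + 1) • y ≠ 0 := nsmul_ne_zero_of_form (by rw [L.symm, hy]) odd_one
  have hwodd := odd_of_anisotropic hL heven hani hytop hw
  have hZ : Nat.card {z : L.G // 2 ^ m • L.form z z = 0} ≤ torsionCard L.G (m + 1) := by
    refine Nat.card_le_card_of_injective
      (Subtype.map (p := fun z : L.G => 2 ^ m • L.form z z = 0)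
        (q := fun z : L.G => 2 ^ (m + 1) • z = 0) id fun z hz => ?_)
      (Subtype.map_injective _ Function.injective_id)
    by_contra hztop
    obtain ⟨b, hb⟩ := exists_form_self_eq_fr_two_mul hL heven z
    have hbodd := odd_of_anisotropic hL heven hani hztop hb
    rw [hb] at hz
    have hz' := (two_pow_nsmul_fr_add_two_eq_zero_iff m _).mp hz
    obtain ⟨c, rfl⟩ := hbodd
    lia
  have hindex : 4 ≤ (torsionSubgroup L.G (m + 1)).index := by
    obtain ⟨i, hi⟩ := L.exists_index_eq_two_pow (m + 1)
    rw [hi]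
    rcases i with _ | _ | i
    · rw [pow_zero, AddSubgroup.index_eq_one] at hi
      have : x ∈ torsionSubgroup L.G (m + 1) := hi ▸ AddSubgroup.mem_top x
      exact absurd this hx
    -- Index two would put `x + y` in the torsion subgroup, but it pairs with `x` to the odd
    -- numerator `2 * u + 1`.
    · have h := (AddSubgroup.add_mem_iff_of_index_two hi (a := x) (b := y)).mpr
        ⟨fun h => absurd h hx, fun h => absurd h hytop⟩
      have h2 := form_comb hu hy hw 1 1 1 0
      refine absurd (mem_torsionSubgroup.mp h) ?_
      have h3 := nsmul_ne_zero_of_form h2 ⟨u, by ring⟩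
      simpa only [one_smul] using h3
    · rw [pow_add, pow_add]
      have : 1 ≤ 2 ^ i := Nat.one_le_two_pow
      lia
  rw [← card_torsion_mul_index L.G (m + 1), mul_comm]
  exact Nat.mul_le_mul hZ hindex

end isotropic

/-- Take `y` of maximal order and `z` pairing to one with it. Both lie in the nontrivial coset, so
`2 ^ n` kills `y + z`, and the norm of `y` inherits the oddness of `λ(y, z)`. -/
theorem exists_odd_of_index_two {L : TwoLinking.{u}} {n : ℕ}
    (hL : ∀ x : L.G, 2 ^ (n + 1) • x = 0) (hidx : (torsionSubgroup L.G n).index = 2) :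
    ∃ y, 2 ^ n • L.form y y ≠ 0 := by
  obtain ⟨y, hy⟩ : ∃ y : L.G, 2 ^ n • y ≠ 0 := by
    by_contra! h
    have : torsionSubgroup L.G n = ⊤ := by
      rw [eq_top_iff]
      exact fun x _ => h x
    rw [this, AddSubgroup.index_top] at hidx
    lia
  obtain ⟨z, hz⟩ := exists_form_eq_fr_one hL hy
  have hztop : 2 ^ n • z ≠ 0 := nsmul_ne_zero_of_form (by rw [L.symm, hz]) odd_one
  have h := (AddSubgroup.add_mem_iff_of_index_two hidx (a := y) (b := z)).mpr
    ⟨fun h => absurd h hy, fun h => absurd h hztop⟩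
  refine ⟨y, fun h0 => ?_⟩
  have h1 : 2 ^ n • L.form (y + z) y = 0 := by
    rw [nsmul_form, mem_torsionSubgroup.mp h]; simp
  rw [map_add, AddMonoidHom.add_apply, nsmul_add, h0, zero_add, L.symm, hz,
    two_pow_nsmul_fr_eq_zero_iff] at h1
  exact absurd h1 (by decide)

/-! ### Characteristic elements. -/

/-- Elements `x` with `2 ^ n λ(x, y) = 2 ^ n λ(y, y)` for all `y`. -/
def IsCharacteristic (L : TwoLinking.{u}) (n : ℕ) (x : L.G) : Prop :=
  ∀ y, 2 ^ n • L.form x y = 2 ^ n • L.form y y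

/-- By nondegeneracy, two characteristic elements differ by an element killed by `2 ^ n`. -/
theorem card_isCharacteristic_le (L : TwoLinking.{u}) (n : ℕ) :
    Nat.card {x // L.IsCharacteristic n x} ≤ torsionCard L.G n := by
  by_cases h : ∃ x₀, L.IsCharacteristic n x₀
  · obtain ⟨x₀, hx₀⟩ := h
    refine Nat.card_le_card_of_injective
      (Subtype.map (p := L.IsCharacteristic n) (q := fun z : L.G => 2 ^ n • z = 0)
        (· - x₀) fun x hx => ?_) (Subtype.map_injective _ (sub_left_injective (b := x₀)))
    refine L.form_eq_zero fun y => ?_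
    rw [← nsmul_form, map_sub, AddMonoidHom.sub_apply, smul_sub, hx y, hx₀ y, sub_self]
  · have : IsEmpty {x // L.IsCharacteristic n x} := ⟨fun x => h ⟨x.1, x.2⟩⟩
    simp

/-- At least half of all elements have odd norm, whereas the characteristic elements of `L` and
those pulled back from `M` each make up at most an eighth. -/
theorem exists_not_isCharacteristic {L M : TwoLinking.{u}} {n : ℕ}
    (hL : ∀ x : L.G, 2 ^ (n + 1) • x = 0) (τ : L.G ≃ M.G)
    (htL : 8 * torsionCard L.G n ≤ Nat.card L.G) (htM : 8 * torsionCard M.G n ≤ Nat.card M.G)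
    (hodd : ∃ x, 2 ^ n • L.form x x ≠ 0) :
    ∃ x, 2 ^ n • L.form x x ≠ 0 ∧ ¬ L.IsCharacteristic n x ∧ ¬ M.IsCharacteristic n (τ x) := by
  classical
  by_contra! hcon
  obtain ⟨x₀, hx₀⟩ := hodd
  let O := Finset.univ.filter fun x => ¬ 2 ^ n • L.form x x = 0
  let C := Finset.univ.filter fun x => L.IsCharacteristic n x
  let D := Finset.univ.filter fun x => M.IsCharacteristic n (τ x)
  have h1 : O.card ≤ C.card + D.card := by
    refine (Finset.card_le_card fun x hx => ?_).trans (Finset.card_union_le C D)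
    simp only [O, C, D, Finset.mem_union, Finset.mem_filter, Finset.mem_univ, true_and] at hx ⊢
    by_cases hc : L.IsCharacteristic n x
    · exact Or.inl hc
    · exact Or.inr (hcon x hx hc)
  have h2 : (Finset.univ.filter fun x => 2 ^ n • L.form x x = 0).card ≤ O.card := by
    refine Finset.card_le_card_of_injOn (· + x₀) ?_ (add_left_injective x₀).injOn
    intro z hz
    simp only [O, Finset.coe_filter, Finset.mem_univ, true_and, Set.mem_ofPred_eq] at hz ⊢
    rw [L.two_pow_nsmul_form_add_self n (hL z), hz, zero_add]
    exact hx₀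
  have h3 := Finset.card_filter_add_card_filter_not (s := (Finset.univ : Finset L.G))
    (fun z => 2 ^ n • L.form z z = 0)
  have h4 : C.card ≤ torsionCard L.G n := by
    refine le_of_eq_of_le ?_ (L.card_isCharacteristic_le n)
    rw [Nat.card_eq_fintype_card, Fintype.card_subtype]
  have h5 : D.card ≤ torsionCard M.G n := by
    refine le_of_eq_of_le ?_ (M.card_isCharacteristic_le n)
    rw [← Fintype.card_subtype, ← Nat.card_eq_fintype_card]
    exact Nat.card_congr (τ.subtypeEquiv fun _ => Iff.rfl)
  have h6 : Nat.card L.G = Nat.card M.G := Nat.card_congr τ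
  have h7 : 0 < Nat.card L.G := Nat.card_pos
  rw [Finset.card_univ, ← Nat.card_eq_fintype_card] at h3
  change _ + O.card = _ at h3
  lia

/-! ### Cancelling a common summand. -/

/-- Equality of all torsion counts and Gauss sums. -/
structure SameInvariants (L M : TwoLinking.{u}) : Prop where
  torsion : ∀ k, torsionCard L.G k = torsionCard M.G k
  gauss : ∀ k, L.gaussSum k = M.gaussSum k

theorem SameInvariants.symm {L M : TwoLinking.{u}} (h : SameInvariants L M) :
    SameInvariants M L := ⟨fun k => (h.torsion k).symm, fun k => (h.gauss k).symm⟩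

theorem SameInvariants.card_eq {L M : TwoLinking.{u}} (h : SameInvariants L M) :
    Nat.card L.G = Nat.card M.G := by
  obtain ⟨τ, -⟩ := exists_equiv_of_gaussSum_eq h.gauss
  exact Nat.card_congr τ

theorem SameInvariants.exponent {L M : TwoLinking.{u}} (h : SameInvariants L M) {k : ℕ}
    (hL : ∀ x : L.G, 2 ^ k • x = 0) : ∀ x : M.G, 2 ^ k • x = 0 := by
  rw [← torsionCard_eq_card_iff] at hL ⊢
  rw [← h.torsion, hL, h.card_eq]

theorem SameInvariants.cancel_torsion {B L M L' M' : TwoLinking.{u}} (h : SameInvariants L M)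
    (hL : Iso (sum B L') L) (hM : Iso (sum B M') M) (k : ℕ) :
    torsionCard L'.G k = torsionCard M'.G k := by
  obtain ⟨e, -⟩ := hL
  obtain ⟨f, -⟩ := hM
  have h1 := h.torsion k
  have h2 := torsionCard_congr e k
  have h3 := torsionCard_congr f k
  have h4 : torsionCard B.G k * torsionCard L'.G k = torsionCard B.G k * torsionCard M'.G k := by
    rw [← torsionCard_prod, ← torsionCard_prod]
    exact h2.trans (h1.trans h3.symm)
  exact Nat.eq_of_mul_eq_mul_left (torsionCard_pos _ _) h4

theorem SameInvariants.cancel_gauss {B L M L' M' : TwoLinking.{u}} (h : SameInvariants L M)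
    (hL : Iso (sum B L') L) (hM : Iso (sum B M') M) (k : ℕ+) (hB : B.gaussSum k ≠ 0) :
    L'.gaussSum k = M'.gaussSum k := by
  have h1 := h.gauss k
  rw [← gaussSum_congr hL, ← gaussSum_congr hM, gaussSum_sum, gaussSum_sum] at h1
  exact mul_left_cancel₀ hB h1

theorem card_eq_of_iso_sum {B L L' : TwoLinking.{u}} (hL : Iso (sum B L') L) :
    Nat.card L.G = Nat.card B.G * Nat.card L'.G := by
  obtain ⟨e, -⟩ := hL
  rw [← Nat.card_prod]
  exact (Nat.card_congr e.toEquiv).symm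

theorem card_lt_of_iso_sum {B L L' : TwoLinking.{u}} (hL : Iso (sum B L') L)
    (hB : 1 < Nat.card B.G) : Nat.card L'.G < Nat.card L.G := by
  rw [card_eq_of_iso_sum hL]
  exact lt_mul_of_one_lt_left Nat.card_pos hB

theorem exists_iso_sum {B L : TwoLinking.{u}} (f : B.G →+ L.G)
    (hf : ∀ x y, L.form (f x) (f y) = B.form x y) : ∃ L', Iso (sum B L') L := by
  obtain ⟨L', e, he, -⟩ := exists_orthogonal_complement f hf
  exact ⟨L', e, he⟩

/-- Nonvanishing Gauss sums of `B` can be divided out, so the complements have the same invariants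
and the induction hypothesis applies. -/
theorem iso_of_common_summand {B L M : TwoLinking.{u}} (h : SameInvariants L M)
    (IH : ∀ L' M' : TwoLinking.{u}, Nat.card L'.G < Nat.card L.G → SameInvariants L' M' →
      Iso L' M') (hB : 1 < Nat.card B.G) (hΓ : ∀ k, B.gaussSum k ≠ 0)
    (hL : ∃ f : B.G →+ L.G, ∀ x y, L.form (f x) (f y) = B.form x y)
    (hM : ∃ f : B.G →+ M.G, ∀ x y, M.form (f x) (f y) = B.form x y) : Iso L M := by
  obtain ⟨f, hf⟩ := hL
  obtain ⟨g, hg⟩ := hM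
  obtain ⟨L', hL'⟩ := exists_iso_sum f hf
  obtain ⟨M', hM'⟩ := exists_iso_sum g hg
  have hI := IH L' M' (card_lt_of_iso_sum hL' hB)
    ⟨h.cancel_torsion hL' hM', fun k => h.cancel_gauss hL' hM' k (hΓ k)⟩
  exact hL'.symm.trans ((sum_congr (Iso.refl B) hI).trans hM')

/-! ### The even case. -/

theorem isUnit_intCast_zmod {N : ℕ} {m : ℤ} (hm : Odd m) : IsUnit (m : ZMod (2 ^ N)) := by
  have hc : IsCoprime m (2 ^ N) := by
    refine IsCoprime.pow_right ?_
    obtain ⟨k, rfl⟩ := hm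
    exact ⟨1, -k, by ring⟩
  obtain ⟨a, b, hab⟩ := hc
  have h : ((a * m + b * 2 ^ N : ℤ) : ZMod (2 ^ N)) = 1 := by rw [hab]; simp
  have h2 : ((2 : ZMod (2 ^ N)) ^ N) = 0 := by
    have := ZMod.natCast_self (2 ^ N)
    push_cast at this
    exact this
  push_cast at h
  rw [h2, mul_zero, add_zero] at h
  exact IsUnit.of_mul_eq_one_right _ h

/-- The even binary Gram matrix with diagonal entries `2 a` and `2 c`. -/
def binaryGram (N : ℕ) (a c : ℤ) : Matrix (Fin 2) (Fin 2) (ZMod (2 ^ N)) :=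
  !![((2 * a : ℤ) : ZMod (2 ^ N)), 1; 1, ((2 * c : ℤ) : ZMod (2 ^ N))]

theorem binaryGram_isSymm (N : ℕ) (a c : ℤ) : (binaryGram N a c).IsSymm := by
  refine Matrix.IsSymm.ext fun i j => ?_
  fin_cases i <;> fin_cases j <;> rfl

theorem isUnit_det_binaryGram (N : ℕ) (a c : ℤ) : IsUnit (binaryGram N a c).det := by
  have h : (binaryGram N a c).det = ((4 * a * c - 1 : ℤ) : ZMod (2 ^ N)) := by
    rw [binaryGram, Matrix.det_fin_two_of]
    push_cast
    ring
  rw [h]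
  exact isUnit_intCast_zmod ⟨2 * a * c - 1, by ring⟩

/-- The even linking pairing of rank two with diagonal entries `2 a` and `2 c`. -/
noncomputable def binaryBlock (N : ℕ) (a c : ℤ) : TwoLinking.{u} :=
  block N 2 (binaryGram N a c) (binaryGram_isSymm N a c) (isUnit_det_binaryGram N a c)

theorem card_block {N r : ℕ} {A : Matrix (Fin r) (Fin r) (ZMod (2 ^ N))} {hs : A.IsSymm}
    {hA : IsUnit A.det} : Nat.card (block.{u} N r A hs hA).G = 2 ^ (N * r) := by
  rw [Nat.card_eq_fintype_card]
  refine (Fintype.card_ulift _).trans ?_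
  rw [Fintype.card_fun, ZMod.card, Fintype.card_fin, ← pow_mul]

theorem one_lt_card_block {n r : ℕ} {A : Matrix (Fin r) (Fin r) (ZMod (2 ^ (n + 1)))}
    {hs : A.IsSymm} {hA : IsUnit A.det} (hr : 0 < r) :
    1 < Nat.card (block.{u} (n + 1) r A hs hA).G := by
  rw [card_block]
  exact Nat.one_lt_two_pow (by positivity)

theorem gaussSum_binaryBlock_ne_zero (n : ℕ) (a c : ℤ) (k : ℕ+) :
    (binaryBlock.{u} (n + 1) a c).gaussSum k ≠ 0 := by
  refine gaussSum_block_ne_zero k ?_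
  by_cases hk : (k : ℕ) = n + 1
  · refine Or.inr fun x => ?_
    rw [hk, Nat.add_sub_cancel, block_form]
    obtain ⟨s, hs⟩ := ZMod.intCast_surjective (x.down 0)
    obtain ⟨t, ht⟩ := ZMod.intCast_surjective (x.down 1)
    have h : x.down ⬝ᵥ (binaryGram (n + 1) a c).mulVec x.down =
        ((2 * (a * s ^ 2 + s * t + c * t ^ 2) : ℤ) : ZMod (2 ^ (n + 1))) := by
      simp only [binaryGram, dotProduct, Matrix.mulVec, Fin.sum_univ_two, ← hs, ← ht,
        Matrix.of_apply, Matrix.cons_val_zero, Matrix.cons_val_one]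
      push_cast
      ring
    rw [h, zmodFr_intCast, two_pow_nsmul_fr_eq_zero_iff]
    exact dvd_mul_right _ _
  · exact Or.inl hk

theorem exists_hom_binaryBlock {L : TwoLinking.{u}} {n : ℕ}
    (hL : ∀ x : L.G, 2 ^ (n + 1) • x = 0) {a c : ℤ} {x y : L.G}
    (hxx : L.form x x = fr (n + 1) (2 * a)) (hxy : L.form x y = fr (n + 1) 1)
    (hyy : L.form y y = fr (n + 1) (2 * c)) :
    ∃ f : (binaryBlock.{u} (n + 1) a c).G →+ L.G,
      ∀ v w, L.form (f v) (f w) = (binaryBlock.{u} (n + 1) a c).form v w := by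
  have h1 : zmodFr (n + 1) 1 = fr (n + 1) 1 := by
    rw [← zmodFr_intCast]; simp
  obtain ⟨f, hf, -⟩ := exists_hom_block (binaryGram_isSymm (n + 1) a c)
    (isUnit_det_binaryGram (n + 1) a c) L ![x, y] (fun i => hL _) (fun i j => by
      fin_cases i <;> fin_cases j
      · exact hxx.trans (zmodFr_intCast _ _).symm
      · exact hxy.trans h1.symm
      · exact (L.symm y x).trans (hxy.trans h1.symm)
      · exact hyy.trans (zmodFr_intCast _ _).symm)
  exact ⟨f, hf⟩

theorem SameInvariants.exists_isotropic {L M : TwoLinking.{u}} {n : ℕ} (h : SameInvariants L M)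
    (hL : ∀ x : L.G, 2 ^ (n + 1) • x = 0) (hLe : ∀ x, 2 ^ n • L.form x x = 0)
    (hMe : ∀ x, 2 ^ n • M.form x x = 0) (hMtop : ∃ x : M.G, 2 ^ n • x ≠ 0)
    (hiso : ∃ x : L.G, 2 ^ n • x ≠ 0 ∧ L.form x x = 0) :
    ∃ x : M.G, 2 ^ n • x ≠ 0 ∧ M.form x x = 0 := by
  by_contra! hcon
  obtain ⟨x, hx, hxx⟩ := hiso
  -- For exponent two, evenness makes every vector isotropic. Otherwise the two counts, equal
  -- through `τ`, lie on opposite sides of one quarter.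
  rcases n with _ | m
  · obtain ⟨y, hy⟩ := hMtop
    exact hcon y hy (by simpa using hMe y)
  · have h1 := card_lt_of_isotropic hL hLe hx hxx
    have h2 := card_le_of_anisotropic (h.exponent hL) hMe hcon hMtop
    obtain ⟨τ, hτ⟩ := exists_equiv_of_gaussSum_eq h.gauss
    have h3 : Nat.card {z : L.G // 2 ^ m • L.form z z = 0} =
        Nat.card {z : M.G // 2 ^ m • M.form z z = 0} :=
      Nat.card_congr (τ.subtypeEquiv fun z => by rw [hτ])
    rw [h3, h.card_eq] at h1
    lia

/-- An isotropic vector of maximal order exists in both pairings or in neither, so both contain a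
hyperbolic plane or both contain the plane with Gram matrix `2, 1; 1, 2`. -/
theorem iso_of_even {L M : TwoLinking.{u}} {n : ℕ} (h : SameInvariants L M)
    (IH : ∀ L' M' : TwoLinking.{u}, Nat.card L'.G < Nat.card L.G → SameInvariants L' M' →
      Iso L' M') (hL : ∀ x : L.G, 2 ^ (n + 1) • x = 0) (hLtop : ∃ x : L.G, 2 ^ n • x ≠ 0)
    (hLe : ∀ x, 2 ^ n • L.form x x = 0) (hMe : ∀ x, 2 ^ n • M.form x x = 0) : Iso L M := by
  have hM := h.exponent hL
  have hMtop : ∃ x : M.G, 2 ^ n • x ≠ 0 := by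
    by_contra! hcon
    obtain ⟨x, hx⟩ := hLtop
    exact hx (h.symm.exponent hcon x)
  by_cases hiso : ∃ x : L.G, 2 ^ n • x ≠ 0 ∧ L.form x x = 0
  · have key : ∀ K : TwoLinking.{u}, (∀ x : K.G, 2 ^ (n + 1) • x = 0) →
        (∀ x, 2 ^ n • K.form x x = 0) → (∃ x : K.G, 2 ^ n • x ≠ 0 ∧ K.form x x = 0) →
        ∃ f : (binaryBlock.{u} (n + 1) 0 0).G →+ K.G,
          ∀ v w, K.form (f v) (f w) = (binaryBlock.{u} (n + 1) 0 0).form v w := by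
      intro K hK hKe ⟨x, hx, hxx⟩
      obtain ⟨y, hxy, hyy⟩ := exists_hyperbolic_pair hK hKe hx hxx
      exact exists_hom_binaryBlock hK (by simpa using hxx) hxy (by simpa using hyy)
    exact iso_of_common_summand h IH (one_lt_card_block (by lia))
      (gaussSum_binaryBlock_ne_zero n 0 0) (key L hL hLe hiso)
      (key M hM hMe (h.exists_isotropic hL hLe hMe hMtop hiso))
  · have hisoM : ¬ ∃ x : M.G, 2 ^ n • x ≠ 0 ∧ M.form x x = 0 := fun hM' =>
      hiso (h.symm.exists_isotropic hM hMe hLe hLtop hM')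
    have key : ∀ K : TwoLinking.{u}, (∀ x : K.G, 2 ^ (n + 1) • x = 0) →
        (∀ x, 2 ^ n • K.form x x = 0) → (¬ ∃ x : K.G, 2 ^ n • x ≠ 0 ∧ K.form x x = 0) →
        (∃ x : K.G, 2 ^ n • x ≠ 0) →
        ∃ f : (binaryBlock.{u} (n + 1) 1 1).G →+ K.G,
          ∀ v w, K.form (f v) (f w) = (binaryBlock.{u} (n + 1) 1 1).form v w := by
      intro K hK hKe hani htop
      push Not at hani
      obtain ⟨x, y, hxx, hxy, hyy⟩ := exists_anisotropic_pair hK hKe hani htop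
      exact exists_hom_binaryBlock hK (by rw [hxx, mul_one]) hxy (by rw [hyy, mul_one])
    exact iso_of_common_summand h IH (one_lt_card_block (by lia))
      (gaussSum_binaryBlock_ne_zero n 1 1) (key L hL hLe hiso hLtop)
      (key M hM hMe hisoM hMtop)

/-! ### The odd case. -/

/-- The cyclic linking pairing `m / 2 ^ N` with `m` odd. -/
noncomputable def cyclicBlock (N : ℕ) (m : ℤ) (hm : Odd m) : TwoLinking.{u} :=
  block N 1 (Matrix.of fun _ _ => (m : ZMod (2 ^ N))) (Matrix.IsSymm.ext fun _ _ => rfl)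
    (by rw [Matrix.det_fin_one]; exact isUnit_intCast_zmod hm)

/-- The standard generator of a cyclic linking pairing. -/
noncomputable def cyclicGen (N : ℕ) (m : ℤ) (hm : Odd m) : (cyclicBlock.{u} N m hm).G :=
  ULift.up (Pi.single 0 1)

theorem exists_hom_cyclicBlock {L : TwoLinking.{u}} {N : ℕ} {x : L.G} (hL : 2 ^ N • x = 0) {m : ℤ}
    (hm : Odd m) (hx : L.form x x = fr N m) :
    ∃ f : (cyclicBlock.{u} N m hm).G →+ L.G,
      (∀ v w, L.form (f v) (f w) = (cyclicBlock.{u} N m hm).form v w) ∧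
      f (cyclicGen N m hm) = x := by
  obtain ⟨f, hf, hf'⟩ := exists_hom_block (A := Matrix.of fun _ _ => (m : ZMod (2 ^ N)))
    (Matrix.IsSymm.ext fun _ _ => rfl)
    (by rw [Matrix.det_fin_one]; exact isUnit_intCast_zmod hm) L (fun _ => x) (fun _ => hL)
    (fun i j => hx.trans (zmodFr_intCast _ _).symm)
  exact ⟨f, hf, hf' 0⟩

/-- This is the congruence `t ≡ t ^ 2` modulo two. -/
theorem isCharacteristic_cyclicGen (n : ℕ) (m : ℤ) (hm : Odd m) :
    (cyclicBlock.{u} (n + 1) m hm).IsCharacteristic n (cyclicGen (n + 1) m hm) := by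
  intro y
  obtain ⟨t, ht⟩ := ZMod.intCast_surjective (y.down 0)
  have h1 : (cyclicBlock.{u} (n + 1) m hm).form (cyclicGen (n + 1) m hm) y =
      fr (n + 1) (m * t) := by
    refine (block_form _ _).trans ?_
    rw [← zmodFr_intCast]
    congr 1
    simp [cyclicGen, dotProduct, Matrix.mulVec, ← ht]
  have h2 : (cyclicBlock.{u} (n + 1) m hm).form y y = fr (n + 1) (m * t * t) := by
    refine (block_form _ _).trans ?_
    rw [← zmodFr_intCast]
    congr 1
    simp [dotProduct, Matrix.mulVec, ← ht]
    ring
  rw [h1, h2, ← sub_eq_zero, ← smul_sub, ← map_sub, two_pow_nsmul_fr_eq_zero_iff]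
  have h3 := Int.even_mul_pred_self t
  rw [even_iff_two_dvd] at h3
  have h4 : m * t - m * t * t = -m * (t * (t - 1)) := by ring
  rw [h4]
  exact h3.mul_left _

/-- Splitting off a cyclic summand, keeping track of the parity of the complement. -/
theorem exists_cyclic_complement {L : TwoLinking.{u}} {n : ℕ}
    (hL : ∀ x : L.G, 2 ^ (n + 1) • x = 0) {x : L.G} {m : ℤ} (hm : Odd m)
    (hx : L.form x x = fr (n + 1) m) :
    ∃ L', Iso (sum (cyclicBlock.{u} (n + 1) m hm) L') L ∧
      (¬ L.IsCharacteristic n x → ∃ y, 2 ^ n • L'.form y y ≠ 0) := by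
  obtain ⟨f, hf, hfx⟩ := exists_hom_cyclicBlock (hL x) hm hx
  obtain ⟨L', e, he, hef⟩ := exists_orthogonal_complement f hf
  refine ⟨L', ⟨e, he⟩, fun hchar => ?_⟩
  by_contra! hcon
  -- If the complement were even it would contribute nothing to `2 ^ n λ(y, y)`, and `x`, being
  -- characteristic in its own summand, would be so in `L`.
  refine hchar fun y => ?_
  obtain ⟨p, rfl⟩ := e.surjective y
  rw [← hfx, ← hef, he, he]
  simp only [map_zero, AddMonoidHom.zero_apply, add_zero, nsmul_add, hcon]
  exact isCharacteristic_cyclicGen n m hm p.1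

theorem gaussSum_eq_zero_iff_of_exponent {L : TwoLinking.{u}} {n : ℕ}
    (hL : ∀ x : L.G, 2 ^ (n + 1) • x = 0) :
    L.gaussSum n.succPNat = 0 ↔ ∃ y, 2 ^ n • L.form y y ≠ 0 := by
  rw [← not_iff_not, ← Ne, gaussSum_ne_zero_iff, Nat.succPNat_coe]
  push Not
  exact ⟨fun h z => h z (hL z), fun h z _ => h z⟩

/-- The summands generated by `x` and `τ x` are the same pairing. Their Gauss sum cannot be
cancelled at `k = n + 1`, so the work lies in showing that the complements have equal parity. -/
theorem iso_of_odd {L M : TwoLinking.{u}} {n : ℕ} (h : SameInvariants L M)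
    (IH : ∀ L' M' : TwoLinking.{u}, Nat.card L'.G < Nat.card L.G → SameInvariants L' M' →
      Iso L' M') (hL : ∀ x : L.G, 2 ^ (n + 1) • x = 0)
    (hodd : ∃ x, 2 ^ n • L.form x x ≠ 0) : Iso L M := by
  have hM := h.exponent hL
  obtain ⟨τ, hτ⟩ := exists_equiv_of_gaussSum_eq h.gauss
  obtain ⟨x, hx, hchar⟩ : ∃ x, 2 ^ n • L.form x x ≠ 0 ∧
      (8 * torsionCard L.G n ≤ Nat.card L.G →
        ¬ L.IsCharacteristic n x ∧ ¬ M.IsCharacteristic n (τ x)) := by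
    by_cases h8 : 8 * torsionCard L.G n ≤ Nat.card L.G
    · obtain ⟨x, hx, hc⟩ := exists_not_isCharacteristic hL τ h8
        (by rw [← h.torsion, ← h.card_eq]; exact h8) hodd
      exact ⟨x, hx, fun _ => hc⟩
    · obtain ⟨x, hx⟩ := hodd
      exact ⟨x, hx, fun h => absurd h h8⟩
  obtain ⟨m, hxm⟩ := exists_form_fr hL x x
  have hm : Odd m := by
    rw [hxm, Ne, two_pow_nsmul_fr_eq_zero_iff, ← even_iff_two_dvd, Int.not_even_iff_odd] at hx
    exact hx
  obtain ⟨L', hL', hLc⟩ := exists_cyclic_complement hL hm hxm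
  obtain ⟨M', hM', hMc⟩ := exists_cyclic_complement hM hm ((hτ x).trans hxm)
  set B := cyclicBlock.{u} (n + 1) m hm
  have hBcard : 1 < Nat.card B.G := one_lt_card_block (by lia)
  have htors := h.cancel_torsion hL' hM'
  have hcard : Nat.card L'.G = Nat.card M'.G := by
    have h1 := h.card_eq
    rw [card_eq_of_iso_sum hL', card_eq_of_iso_sum hM'] at h1
    exact Nat.eq_of_mul_eq_mul_left (by lia) h1
  have kill : ∀ {K K' : TwoLinking.{u}}, Iso (sum B K') K → (∀ x : K.G, 2 ^ (n + 1) • x = 0) →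
      ∀ y : K'.G, 2 ^ (n + 1) • y = 0 := by
    rintro K K' ⟨e, -⟩ hK y
    let z : (sum B K').G := ((0 : B.G), y)
    have h1 : 2 ^ (n + 1) • z = 0 := e.injective (by rw [map_nsmul, map_zero, hK])
    exact congrArg Prod.snd h1
  have hL'e := kill hL' hL
  have hM'e := kill hM' hM
  have hindex : (torsionSubgroup L'.G n).index = (torsionSubgroup M'.G n).index := by
    have h1 := card_torsion_mul_index L'.G n
    rw [hcard, ← card_torsion_mul_index M'.G n, htors] at h1
    exact Nat.eq_of_mul_eq_mul_left (torsionCard_pos _ _) h1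
  -- If the `2 ^ n`-torsion of `L` has index at least eight, both complements are odd by the choice
  -- of `x`. Otherwise its index in each complement is one or two, forcing an even or odd form
  -- respectively.
  have hparity : (∃ y, 2 ^ n • L'.form y y ≠ 0) ↔ ∃ y, 2 ^ n • M'.form y y ≠ 0 := by
    by_cases h8 : 8 * torsionCard L.G n ≤ Nat.card L.G
    · exact iff_of_true (hLc (hchar h8).1) (hMc (hchar h8).2)
    · obtain ⟨i, hi⟩ := L'.exists_index_eq_two_pow n
      rcases i with _ | _ | i
      · have even : ∀ K : TwoLinking.{u}, (torsionSubgroup K.G n).index = 1 →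
            ¬ ∃ y, 2 ^ n • K.form y y ≠ 0 := by
          rintro K hK ⟨y, hy⟩
          rw [AddSubgroup.index_eq_one] at hK
          have hy' : y ∈ torsionSubgroup K.G n := hK ▸ AddSubgroup.mem_top y
          rw [nsmul_form, mem_torsionSubgroup.mp hy'] at hy
          simp at hy
        exact iff_of_false (even L' hi) (even M' (hindex ▸ hi))
      · exact iff_of_true (exists_odd_of_index_two hL'e hi)
          (exists_odd_of_index_two hM'e (hindex ▸ hi))
      · refine absurd ?_ h8
        -- Index at least two in `B` and at least four in `L'` multiply to at least eight in `L`.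
        have h1 : 2 * torsionCard B.G n ≤ Nat.card B.G := by
          obtain ⟨j, hj⟩ := B.exists_index_eq_two_pow n
          rw [← card_torsion_mul_index B.G n, hj, mul_comm]
          refine Nat.mul_le_mul_left _ ?_
          rcases j with _ | j
          · rw [pow_zero, AddSubgroup.index_eq_one] at hj
            have hall : ∀ y : B.G, 2 ^ n • y = 0 := fun y => by
              have hy : y ∈ torsionSubgroup B.G n := hj ▸ AddSubgroup.mem_top _
              exact hy
            obtain ⟨f, hf, hfx⟩ := exists_hom_cyclicBlock (hL x) hm hxm
            have h2 : 2 ^ n • x = 0 := by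
              rw [← hfx, ← map_nsmul]
              exact (congrArg f (hall _)).trans (map_zero f)
            exact absurd h2 (nsmul_ne_zero_of_form hxm hm)
          · exact Nat.le_self_pow (by lia) 2
        have h2 : 4 * torsionCard L'.G n ≤ Nat.card L'.G := by
          rw [← card_torsion_mul_index L'.G n, hi, mul_comm]
          refine Nat.mul_le_mul_left _ ?_
          rw [pow_add, pow_add]
          have : 1 ≤ 2 ^ i := Nat.one_le_two_pow
          lia
        have h3 : torsionCard L.G n = torsionCard B.G n * torsionCard L'.G n := by
          rw [← torsionCard_prod]
          obtain ⟨e, -⟩ := hL'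
          exact (torsionCard_congr e n).symm
        rw [h3, card_eq_of_iso_sum hL']
        calc 8 * (torsionCard B.G n * torsionCard L'.G n) =
            (2 * torsionCard B.G n) * (4 * torsionCard L'.G n) := by ring
          _ ≤ _ := Nat.mul_le_mul h1 h2
  have hgauss : ∀ k, L'.gaussSum k = M'.gaussSum k := by
    intro k
    by_cases hk : k = n.succPNat
    · subst hk
      by_cases h0 : ∃ y, 2 ^ n • L'.form y y ≠ 0
      · rw [(gaussSum_eq_zero_iff_of_exponent hL'e).mpr h0,
          (gaussSum_eq_zero_iff_of_exponent hM'e).mpr (hparity.mp h0)]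
      · rw [L'.gaussSum_of_exponent n.succPNat hL'e
          (mt (gaussSum_eq_zero_iff_of_exponent hL'e).mp h0),
          M'.gaussSum_of_exponent n.succPNat hM'e
          (mt (gaussSum_eq_zero_iff_of_exponent hM'e).mp (mt hparity.mpr h0)),
          ← Nat.card_eq_fintype_card, ← Nat.card_eq_fintype_card, hcard]
    · refine h.cancel_gauss hL' hM' k (gaussSum_block_ne_zero k (Or.inl fun hk' => hk ?_))
      exact PNat.coe_injective hk'
  have hI := IH L' M' (card_lt_of_iso_sum hL' hBcard) ⟨htors, hgauss⟩
  exact hL'.symm.trans ((sum_congr (Iso.refl B) hI).trans hM')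

theorem iso_of_subsingleton {L M : TwoLinking.{u}} [Subsingleton L.G] [Subsingleton M.G] :
    Iso L M :=
  ⟨⟨⟨fun _ => 0, fun _ => 0, fun _ => Subsingleton.elim _ _, fun _ => Subsingleton.elim _ _⟩,
    fun _ _ => Subsingleton.elim _ _⟩, fun x y => by rw [Subsingleton.elim x 0, map_zero]; simp⟩

/-! ### Classification by torsion counts and Gauss sums. -/

/-- Torsion counts and Gauss sums classify linking pairings on finite 2-groups. -/
theorem iso_of_sameInvariants {L M : TwoLinking.{u}} (h : SameInvariants L M) : Iso L M := by
  induction hc : Nat.card L.G using Nat.strong_induction_on generalizing L M with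
  | _ c ih =>
  subst hc
  have IH : ∀ L' M' : TwoLinking.{u}, Nat.card L'.G < Nat.card L.G → SameInvariants L' M' →
      Iso L' M' := fun L' M' hlt h' => ih _ hlt h' rfl
  rcases lt_or_ge 1 (Nat.card L.G) with hlt | hle
  · obtain ⟨n, hn, htop⟩ := L.exists_exponent (by rwa [← Nat.card_eq_fintype_card])
    by_cases hodd : ∃ x, 2 ^ n • L.form x x ≠ 0
    · exact iso_of_odd h IH hn hodd
    · push Not at hodd
      refine iso_of_even h IH hn htop hodd fun x => ?_
      obtain ⟨τ, hτ⟩ := exists_equiv_of_gaussSum_eq h.gauss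
      obtain ⟨y, rfl⟩ := τ.surjective x
      rw [hτ, hodd]
  · have h1 : Subsingleton L.G := Finite.card_le_one_iff_subsingleton.mp hle
    have h2 : Subsingleton M.G := Finite.card_le_one_iff_subsingleton.mp (h.card_eq ▸ hle)
    exact iso_of_subsingleton

/-! ### Existence and additivity of ranks. -/

theorem isInternal_iff_iSupIndep_and_iSup_eq_top {ι G : Type*} [DecidableEq ι] [AddCommGroup G]
    (H : ι → AddSubgroup G) :
    DirectSum.IsInternal H ↔ iSupIndep H ∧ iSup H = ⊤ := by
  constructor
  · refine fun h => ⟨h.addSubgroup_iSupIndep, eq_top_iff.mpr fun x _ => ?_⟩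
    obtain ⟨d, rfl⟩ := h.2 x
    induction d using DirectSum.induction_on with
    | zero => rw [map_zero]; exact zero_mem _
    | of i y =>
      rw [DirectSum.coeAddMonoidHom_of]
      exact AddSubgroup.mem_iSup_of_mem i y.2
    | add a b ha hb => rw [map_add]; exact add_mem (ha (AddSubgroup.mem_top _)) (hb (AddSubgroup.mem_top _))
  · rintro ⟨hi, hs⟩
    refine ⟨hi.dfinsuppSumAddHom_injective, fun x => ?_⟩
    have hle : iSup H ≤ (DirectSum.coeAddMonoidHom H).range := iSup_le fun i y hy =>
      ⟨DirectSum.of (fun i => H i) i ⟨y, hy⟩, DirectSum.coeAddMonoidHom_of _ _ _⟩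
    exact hle (hs ▸ AddSubgroup.mem_top x)

theorem HasRanks.congr {L M : TwoLinking.{u}} (h : Iso L M) {r : ℕ+ → ℕ} (hL : L.HasRanks r) :
    M.HasRanks r := by
  obtain ⟨e, he⟩ := h
  obtain ⟨H, hint, horth, hfree⟩ := hL
  rw [isInternal_iff_iSupIndep_and_iSup_eq_top] at hint
  refine ⟨fun k => e.mapAddSubgroup (H k), ?_, ?_, fun k => ?_⟩
  · rw [isInternal_iff_iSupIndep_and_iSup_eq_top]
    refine ⟨hint.1.map_orderIso e.mapAddSubgroup, ?_⟩
    rw [← OrderIso.map_iSup, hint.2, OrderIso.map_top]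
  · rintro i j hij _ ⟨x, hx, rfl⟩ _ ⟨y, hy, rfl⟩
    exact (he x y).trans (horth i j hij x hx y hy)
  · obtain ⟨f⟩ := hfree k
    exact ⟨(e.addSubgroupMap (H k)).symm.trans f⟩

theorem HasRanks.sum {L M : TwoLinking.{u}} {r s : ℕ+ → ℕ} (hL : L.HasRanks r)
    (hM : M.HasRanks s) : (L.sum M).HasRanks (fun k => r k + s k) := by
  obtain ⟨H, hHint, hHorth, hHfree⟩ := hL
  obtain ⟨K, hKint, hKorth, hKfree⟩ := hM
  rw [isInternal_iff_iSupIndep_and_iSup_eq_top] at hHint hKint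
  let P : ℕ+ → AddSubgroup (L.G × M.G) := fun k => (H k).prod (K k)
  refine ⟨P, ?_, ?_, fun k => ?_⟩
  · refine (isInternal_iff_iSupIndep_and_iSup_eq_top P).mpr ⟨?_, ?_⟩
    · intro k
      have h1 : (⨆ j, ⨆ (_ : j ≠ k), P j) ≤
          (⨆ j, ⨆ (_ : j ≠ k), H j).prod (⨆ j, ⨆ (_ : j ≠ k), K j) :=
        iSup₂_le fun j hj x hx => ⟨le_iSup₂_of_le (f := fun j (_ : j ≠ k) => H j) j hj le_rfl hx.1,
          le_iSup₂_of_le (f := fun j (_ : j ≠ k) => K j) j hj le_rfl hx.2⟩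
      refine Disjoint.mono_right h1 ?_
      rw [AddSubgroup.disjoint_def]
      rintro ⟨x, y⟩ hxy hxy'
      have hx := AddSubgroup.disjoint_def.mp (hHint.1 k) hxy.1 hxy'.1
      have hy := AddSubgroup.disjoint_def.mp (hKint.1 k) hxy.2 hxy'.2
      exact Prod.ext hx hy
    · rw [eq_top_iff]
      rintro ⟨x, y⟩ -
      have h1 : iSup H ≤ (iSup P).comap (AddMonoidHom.inl L.G M.G) := iSup_le fun k x hx =>
        AddSubgroup.mem_iSup_of_mem (S := P) k ⟨hx, zero_mem _⟩
      have h2 : iSup K ≤ (iSup P).comap (AddMonoidHom.inr L.G M.G) := iSup_le fun k x hx =>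
        AddSubgroup.mem_iSup_of_mem (S := P) k ⟨zero_mem _, hx⟩
      have hx := h1 (hHint.2 ▸ AddSubgroup.mem_top x)
      have hy := h2 (hKint.2 ▸ AddSubgroup.mem_top y)
      have := add_mem (AddSubgroup.mem_comap.mp hx) (AddSubgroup.mem_comap.mp hy)
      simpa using this
  · rintro i j hij ⟨x, y⟩ hxy ⟨x', y'⟩ hxy'
    change L.form x x' + M.form y y' = 0
    rw [hHorth i j hij x hxy.1 x' hxy'.1, hKorth i j hij y hxy.2 y' hxy'.2, add_zero]
  · obtain ⟨f⟩ := hHfree k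
    obtain ⟨g⟩ := hKfree k
    refine ⟨((H k).prodEquiv (K k)).trans ((f.prodCongr g).trans ?_)⟩
    exact ((LinearEquiv.funCongrLeft ℕ (ZMod (2 ^ (k : ℕ))) finSumFinEquiv).trans
      (LinearEquiv.sumArrowLequivProdArrow (Fin (r k)) (Fin (s k)) ℕ
        (ZMod (2 ^ (k : ℕ))))).symm.toAddEquiv

theorem hasRanks_trivial : (trivial.{u}).HasRanks 0 := by
  have hsub : Subsingleton (trivial.{u}).G := inferInstanceAs (Subsingleton PUnit)
  refine ⟨fun _ => ⊥, ?_, fun i j _ x hx y hy => ?_, fun k => ?_⟩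
  · rw [isInternal_iff_iSupIndep_and_iSup_eq_top]
    exact ⟨fun k => disjoint_bot_left, Subsingleton.elim _ _⟩
  · rw [Subsingleton.elim x 0]; simp
  · have : Unique (Fin ((0 : ℕ+ → ℕ) k) → ZMod (2 ^ (k : ℕ))) :=
      inferInstanceAs (Unique (Fin 0 → ZMod (2 ^ (k : ℕ))))
    exact ⟨AddEquiv.ofUnique⟩

theorem hasRanks_block (N : ℕ+) (r : ℕ) {A : Matrix (Fin r) (Fin r) (ZMod (2 ^ (N : ℕ)))}
    {hs : A.IsSymm} {hA : IsUnit A.det} :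
    (block.{u} N r A hs hA).HasRanks (fun k => if k = N then r else 0) := by
  refine ⟨fun k => if k = N then ⊤ else ⊥, ?_, fun i j hij x hx y hy => ?_, fun k => ?_⟩
  · rw [isInternal_iff_iSupIndep_and_iSup_eq_top]
    refine ⟨fun k => ?_, eq_top_iff.mpr (le_iSup_of_le N (by simp))⟩
    by_cases hk : k = N
    · have : (⨆ j, ⨆ (_ : j ≠ k),
          (if j = N then ⊤ else ⊥ : AddSubgroup (block.{u} N r A hs hA).G)) = ⊥ := by
        simp only [iSup_eq_bot]
        intro j hj
        rw [if_neg (hk ▸ hj)]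
      rw [this]
      exact disjoint_bot_right
    · simp only [if_neg hk]
      exact disjoint_bot_left
  · by_cases hi : i = N
    · have hj : j ≠ N := fun h => hij (hi.trans h.symm)
      simp only [if_neg hj, AddSubgroup.mem_bot] at hy
      rw [hy, map_zero]
    · simp only [if_neg hi, AddSubgroup.mem_bot] at hx
      rw [hx, map_zero, AddMonoidHom.zero_apply]
  · by_cases hk : k = N
    · subst hk
      have key : ∀ (K : AddSubgroup (block.{u} k r A hs hA).G) (s : ℕ), K = ⊤ → s = r →
          Nonempty (K ≃+ (Fin s → ZMod (2 ^ (k : ℕ)))) := by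
        rintro K s rfl hs
        subst hs
        exact ⟨AddSubgroup.topEquiv.trans AddEquiv.ulift⟩
      exact key _ _ (if_pos rfl) (if_pos rfl)
    · have key : ∀ (K : AddSubgroup (block.{u} N r A hs hA).G) (s : ℕ), K = ⊥ → s = 0 →
          Nonempty (K ≃+ (Fin s → ZMod (2 ^ (k : ℕ)))) := by
        rintro K s rfl rfl
        exact ⟨AddEquiv.ofUnique⟩
      exact key _ _ (if_neg hk) (if_neg hk)

/-- Induction on the order: an odd norm yields a cyclic summand of maximal exponent, and an even
form yields a binary one. -/
theorem exists_hasRanks (L : TwoLinking.{u}) : ∃ r, L.HasRanks r := by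
  induction hc : Nat.card L.G using Nat.strong_induction_on generalizing L with
  | _ c ih =>
  subst hc
  rcases lt_or_ge 1 (Nat.card L.G) with hlt | hle
  · obtain ⟨n, hn, x, hx⟩ := L.exists_exponent (by rwa [← Nat.card_eq_fintype_card])
    suffices h : ∃ (r : ℕ) (A : Matrix (Fin r) (Fin r) (ZMod (2 ^ (n + 1)))) (hs : A.IsSymm)
        (hA : IsUnit A.det), 0 < r ∧ ∃ f : (block.{u} (n + 1) r A hs hA).G →+ L.G,
          ∀ v w, L.form (f v) (f w) = (block.{u} (n + 1) r A hs hA).form v w by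
      obtain ⟨r, A, hs, hA, hr, f, hf⟩ := h
      obtain ⟨L', hL'⟩ := exists_iso_sum f hf
      obtain ⟨s, hs'⟩ := ih _ (card_lt_of_iso_sum hL' (one_lt_card_block hr)) L' rfl
      exact ⟨_, ((hasRanks_block n.succPNat r).sum hs').congr hL'⟩
    by_cases hodd : ∃ x, 2 ^ n • L.form x x ≠ 0
    · obtain ⟨x, hx⟩ := hodd
      obtain ⟨m, hm⟩ := exists_form_fr hn x x
      rw [hm, Ne, two_pow_nsmul_fr_eq_zero_iff, ← even_iff_two_dvd, Int.not_even_iff_odd] at hx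
      obtain ⟨f, hf, -⟩ := exists_hom_cyclicBlock (hn x) hx hm
      exact ⟨1, _, _, _, one_pos, f, hf⟩
    · push Not at hodd
      obtain ⟨y, hy⟩ := exists_form_eq_fr_one hn hx
      obtain ⟨a, ha⟩ := exists_form_self_eq_fr_two_mul hn hodd x
      obtain ⟨c, hc⟩ := exists_form_self_eq_fr_two_mul hn hodd y
      obtain ⟨f, hf⟩ := exists_hom_binaryBlock hn ha hy hc
      exact ⟨2, _, _, _, two_pos, f, hf⟩
  · have h1 : Subsingleton L.G := Finite.card_le_one_iff_subsingleton.mp hle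
    have h2 : Subsingleton (trivial.{u}).G := inferInstanceAs (Subsingleton PUnit)
    exact ⟨0, hasRanks_trivial.congr iso_of_subsingleton⟩

/-! ### Uniqueness of ranks. -/

/-- The standard abelian 2-group with given ranks. -/
abbrev StdGroup (r : ℕ+ → ℕ) : Type := DirectSum ℕ+ fun k => Fin (r k) → ZMod (2 ^ (k : ℕ))

theorem HasRanks.nonempty_addEquiv {L : TwoLinking.{u}} {r : ℕ+ → ℕ} (h : L.HasRanks r) :
    Nonempty (L.G ≃+ StdGroup r) := by
  obtain ⟨H, hint, -, hfree⟩ := h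
  have f := fun k => (hfree k).some
  exact ⟨(AddEquiv.ofBijective _ hint).symm.trans (DirectSum.congrAddEquiv f)⟩

/-- Elements of order at most two which are divisible by `2 ^ k`. -/
def socle (A : Type*) [AddCommGroup A] (k : ℕ) : Set A :=
  {x | 2 • x = 0 ∧ ∃ y, 2 ^ k • y = x}

theorem card_socle_congr {A B : Type*} [AddCommGroup A] [AddCommGroup B] (e : A ≃+ B) (k : ℕ) :
    Nat.card (socle A k) = Nat.card (socle B k) := by
  refine Nat.card_congr (e.toEquiv.subtypeEquiv fun x => ?_)
  change (2 • x = 0 ∧ ∃ y, 2 ^ k • y = x) ↔ (2 • e x = 0 ∧ ∃ y, 2 ^ k • y = e x)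
  rw [← map_nsmul, e.map_eq_zero_iff]
  refine and_congr Iff.rfl ⟨?_, ?_⟩
  · rintro ⟨y, rfl⟩
    exact ⟨e y, (map_nsmul e _ _).symm⟩
  · rintro ⟨y, hy⟩
    exact ⟨e.symm y, by rw [← map_nsmul, hy, e.symm_apply_apply]⟩

theorem exists_nsmul_of_two_nsmul {m r : ℕ} (v : Fin r → ZMod (2 ^ (m + 1))) (hv : 2 • v = 0) :
    ∃ w, 2 ^ m • w = v := by
  have h1 : ∀ i, ∃ z : ZMod (2 ^ (m + 1)), v i = 2 ^ m • z := fun i => by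
    have h := exists_eq_nsmul_zmod (N := m + 1) (k := 1) (by lia) (v i)
      (by simpa using congrFun hv i)
    simpa using h
  choose w hw using h1
  exact ⟨w, (funext hw).symm⟩

theorem exists_nsmul_of_forall {r : ℕ+ → ℕ} (c : ℕ) (x : StdGroup r)
    (h : ∀ k, ∃ y, c • y = x k) : ∃ y, c • y = x := by
  classical
  choose y hy using h
  have hx : x ∈ (nsmulAddMonoidHom (α := StdGroup r) c).range := by
    rw [← DirectSum.sum_support_of x]
    refine sum_mem fun k _ => ⟨DirectSum.of _ k (y k), ?_⟩
    rw [nsmulAddMonoidHom_apply, ← map_nsmul, hy]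
  exact hx

/-- The number of elements of `ℤ/n` killed by two. -/
noncomputable def twoTorsionCard (n : ℕ) : ℕ := Nat.card {z : ZMod n // 2 • z = 0}

theorem two_le_twoTorsionCard (m : ℕ) : 2 ≤ twoTorsionCard (2 ^ (m + 1)) := by
  have : Nontrivial {z : ZMod (2 ^ (m + 1)) // 2 • z = 0} := by
    refine ⟨⟨0, smul_zero _⟩, ⟨((2 ^ m : ℕ) : ZMod (2 ^ (m + 1))), ?_⟩, fun h => ?_⟩
    · rw [nsmul_eq_mul, ← Nat.cast_mul, ← pow_succ', ZMod.natCast_self]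
    · have h1 := (Subtype.ext_iff.mp h).symm
      rw [ZMod.natCast_eq_zero_iff] at h1
      exact absurd (Nat.le_of_dvd (by positivity) h1)
        (not_le.mpr (Nat.pow_lt_pow_right (by lia) (by lia)))
  exact Finite.one_lt_card

/-- In the component of exponent `2 ^ j`, every element killed by two is divisible by `2 ^ (j - 1)`,
but only zero is divisible by `2 ^ j`. Raising `m` by one therefore loses exactly the component `j =
m + 1`, so ratios of consecutive counts reveal the ranks. -/
theorem card_socle_stdGroup (r : ℕ+ → ℕ) (m : ℕ) :
    Nat.card (socle (StdGroup r) m) =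
      twoTorsionCard (2 ^ (m + 1)) ^ r m.succPNat * Nat.card (socle (StdGroup r) (m + 1)) := by
  classical
  set k := m.succPNat with hk
  have hkm : (k : ℕ) = m + 1 := rfl
  have hcard : Nat.card {v : Fin (r k) → ZMod (2 ^ (k : ℕ)) // 2 • v = 0} =
      twoTorsionCard (2 ^ (m + 1)) ^ r k := by
    have h1 : Nat.card (Fin (r k) → {z : ZMod (2 ^ (k : ℕ)) // 2 • z = 0}) =
        twoTorsionCard (2 ^ (m + 1)) ^ r k := by
      rw [Nat.card_fun, Nat.card_fin]
      rfl
    rw [← h1]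
    refine Nat.card_congr ((Equiv.subtypeEquivRight fun v => ?_).trans Equiv.subtypePiEquivPi)
    exact funext_iff
  rw [← hcard, ← Nat.card_prod]
  have hdiv : ∀ (j : ℕ+) (z : Fin (r j) → ZMod (2 ^ (j : ℕ))), 2 • z = 0 → m + 1 ≤ j →
      ∃ y, 2 ^ ((j : ℕ) - 1) • y = z := by
    intro j z hz hj
    obtain ⟨i, rfl⟩ : ∃ i : ℕ, j = i.succPNat := ⟨j.natPred, (PNat.succPNat_natPred j).symm⟩
    exact exists_nsmul_of_two_nsmul z hz
  have hzero : ∀ (j : ℕ+) (c : ℕ) (y : Fin (r j) → ZMod (2 ^ (j : ℕ))), (j : ℕ) ≤ c →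
      2 ^ c • y = 0 := by
    intro j c y hc
    obtain ⟨d, hd⟩ := pow_dvd_pow 2 hc
    rw [hd, mul_comm, mul_smul]
    have : 2 ^ (j : ℕ) • y = 0 := funext fun i => two_pow_nsmul_zmod _ _
    rw [this, smul_zero]
  refine (Nat.card_congr (Equiv.ofBijective (fun p : {v : Fin (r k) → ZMod (2 ^ (k : ℕ)) //
    2 • v = 0} × socle (StdGroup r) (m + 1) =>
      (⟨DirectSum.of _ k p.1.1 + p.2.1, ?_⟩ : socle (StdGroup r) m)) ⟨?_, ?_⟩)).symm
  · obtain ⟨⟨v, hv⟩, ⟨x, hx, y, hy⟩⟩ := p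
    obtain ⟨w, hw⟩ := hdiv k v hv le_rfl
    refine ⟨?_, DirectSum.of _ k w + 2 • y, ?_⟩
    · rw [smul_add, ← map_nsmul, hv, map_zero, hx, add_zero]
    · rw [smul_add, ← map_nsmul, ← mul_smul, ← pow_succ, hy]
      congr 2
  · rintro ⟨⟨v, hv⟩, ⟨x, hx, y, hy⟩⟩ ⟨⟨v', hv'⟩, ⟨x', hx', y', hy'⟩⟩ h
    have h1 : DirectSum.of (fun k => Fin (r k) → ZMod (2 ^ (k : ℕ))) k v + x =
        DirectSum.of (fun k => Fin (r k) → ZMod (2 ^ (k : ℕ))) k v' + x' :=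
      congrArg Subtype.val h
    have hxk : x k = 0 := by
      rw [← hy]
      exact hzero k (m + 1) (y k) le_rfl
    have hxk' : x' k = 0 := by
      rw [← hy']
      exact hzero k (m + 1) (y' k) le_rfl
    have h2 : v = v' := by
      have h3 := congrArg (fun d : StdGroup r => d k) h1
      simpa only [DirectSum.add_apply, DirectSum.of_eq_same, hxk, hxk', add_zero] using h3
    subst h2
    have h3 : x = x' := add_left_cancel h1
    subst h3
    rfl
  · rintro ⟨x, hx, y, hy⟩
    have hcomp : ∀ j, 2 • x j = 0 := fun j => congrArg (fun d : StdGroup r => d j) hx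
    refine ⟨(⟨x k, hcomp k⟩, ⟨x - DirectSum.of _ k (x k), ?_, ?_⟩), ?_⟩
    · rw [smul_sub, hx, ← map_nsmul, hcomp, map_zero, sub_zero]
    · refine exists_nsmul_of_forall _ _ fun j => ?_
      rw [DirectSum.sub_apply]
      rcases lt_trichotomy j k with hj | hj | hj
      · refine ⟨0, ?_⟩
        rw [DirectSum.of_eq_of_ne _ _ _ hj.ne, sub_zero, smul_zero, ← hy]
        exact (hzero j m (y j) (Nat.lt_succ_iff.mp hj)).symm
      · subst hj
        exact ⟨0, by rw [DirectSum.of_eq_same, sub_self, smul_zero]⟩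
      · have hj' : m + 1 < j := hj
        obtain ⟨w, hw⟩ := hdiv j (x j) (hcomp j) hj'.le
        refine ⟨2 ^ ((j : ℕ) - 1 - (m + 1)) • w, ?_⟩
        rw [DirectSum.of_eq_of_ne _ _ _ hj.ne', sub_zero, ← hw, ← mul_smul, ← pow_add]
        congr 2
        lia
    · exact Subtype.ext (add_sub_cancel _ _)

theorem HasRanks.unique {L : TwoLinking.{u}} {r s : ℕ+ → ℕ} (hr : L.HasRanks r)
    (hs : L.HasRanks s) : r = s := by
  obtain ⟨e⟩ := hr.nonempty_addEquiv
  obtain ⟨f⟩ := hs.nonempty_addEquiv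
  funext k
  obtain ⟨m, rfl⟩ : ∃ m : ℕ, k = m.succPNat := ⟨k.natPred, (PNat.succPNat_natPred k).symm⟩
  have h1 := card_socle_stdGroup r m
  have h2 := card_socle_stdGroup s m
  rw [← card_socle_congr e, ← card_socle_congr e] at h1
  rw [← card_socle_congr f, ← card_socle_congr f, h1] at h2
  have : Nonempty (socle L.G (m + 1)) := ⟨⟨0, smul_zero _, 0, smul_zero _⟩⟩
  exact Nat.pow_right_injective (two_le_twoTorsionCard m)
    (Nat.eq_of_mul_eq_mul_right Nat.card_pos h2)

/-! ### Tableaux as a complete additive invariant. -/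

theorem exists_hasInvariants (L : TwoLinking.{u}) : ∃ T, L.HasInvariants T := by
  obtain ⟨r, hr⟩ := L.exists_hasRanks
  choose s hs using L.exists_hasSignature
  exact ⟨fun k => (r k, s k), hr, hs⟩

theorem HasInvariants.unique {L : TwoLinking.{u}} {T T' : Tableau} (h : L.HasInvariants T)
    (h' : L.HasInvariants T') : T = T' :=
  funext fun k => Prod.ext (congrFun (h.1.unique h'.1) k) ((h.2 k).unique (h'.2 k))

theorem HasInvariants.congr {L M : TwoLinking.{u}} (e : Iso L M) {T : Tableau}
    (h : L.HasInvariants T) : M.HasInvariants T :=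
  ⟨h.1.congr e, fun k => (h.2 k).congr e⟩

theorem HasInvariants.sum {L M : TwoLinking.{u}} {T T' : Tableau} (h : L.HasInvariants T)
    (h' : M.HasInvariants T') : (L.sum M).HasInvariants (T + T') :=
  ⟨h.1.sum h'.1, fun k => (h.2 k).sum (h'.2 k)⟩

theorem hasInvariants_trivial : (trivial.{u}).HasInvariants 0 :=
  ⟨hasRanks_trivial, hasSignature_trivial⟩

/-- The ranks determine the group, hence all torsion counts; with these, the signatures determine
the Gauss sums. -/
theorem HasInvariants.iso {L M : TwoLinking.{u}} {T : Tableau} (hL : L.HasInvariants T)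
    (hM : M.HasInvariants T) : Iso L M := by
  obtain ⟨e⟩ := hL.1.nonempty_addEquiv
  obtain ⟨f⟩ := hM.1.nonempty_addEquiv
  let g := e.trans f.symm
  have htors : ∀ k, torsionCard L.G k = torsionCard M.G k := torsionCard_congr g
  exact iso_of_sameInvariants ⟨htors, fun k => gaussSum_eq_of_hasSignature (hL.2 k) (hM.2 k)
    (Fintype.card_congr g.toEquiv) (htors k)⟩

end TwoLinking

theorem mainTheorem2 :
    ∃ Tadm : AddSubmonoid Tableau,
      (∀ T : Tableau, T ∈ Tadm ↔ Tableau.IsAdmissible.{u} T) ∧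
      ∃ φ : LinkingMonoid.{u} ≃+ Tadm,
        ∀ (L : TwoLinking.{u}) (T : Tableau),
          (φ (LinkingMonoid.mk L) : Tableau) = T ↔ L.HasInvariants T := by
  let Tadm : AddSubmonoid Tableau :=
    { carrier := {T | Tableau.IsAdmissible.{u} T}
      zero_mem' := ⟨_, TwoLinking.hasInvariants_trivial⟩
      add_mem' := fun ⟨L, hL⟩ ⟨M, hM⟩ => ⟨L.sum M, hL.sum hM⟩ }
  choose inv hinv using TwoLinking.exists_hasInvariants.{u}
  let φ₀ : LinkingMonoid.{u} → Tadm :=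
    Quotient.lift (fun L => (⟨inv L, L, hinv L⟩ : Tadm)) fun L M h =>
      Subtype.ext (((hinv L).congr h).unique (hinv M))
  have hbij : Function.Bijective φ₀ :=
    ⟨fun a b => Quotient.inductionOn₂ a b fun L M h => by
        have h' : inv L = inv M := congrArg Subtype.val h
        exact Quotient.sound ((hinv L).iso (h' ▸ hinv M)),
      fun ⟨T, L, hL⟩ => ⟨LinkingMonoid.mk L, Subtype.ext ((hinv L).unique hL)⟩⟩
  let φ : LinkingMonoid.{u} ≃+ Tadm :=
    { Equiv.ofBijective φ₀ hbij with
      map_add' := fun a b => Quotient.inductionOn₂ a b fun L M =>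
        Subtype.ext ((hinv (L.sum M)).unique ((hinv L).sum (hinv M))) }
  refine ⟨Tadm, fun T => Iff.rfl, φ, fun L T => ⟨?_, fun h => (hinv L).unique h⟩⟩
  rintro rfl
  exact hinv L
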